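/- Let $\mathcal X=\{-1,+1\}^{\mathbb Z_-}$ (where $\mathbb Z_-=\{0,-1,-2,\dots\}$) with its Borel $\sigma$-algebra $\mathcal B$, let $T:\mathcal X\to\mathcal X$, $(Tx)_i=x_{i-1}$, be the shift, and for $a\in\{-1,+1\}$ and $x\in\mathcal X$ let $ax\in\mathcal X$ be the concatenation, $(ax)_0=a$ and $(ax)_{i-1}=x_i$ for $i\le 0$. For $\epsilon\in(0,1/2)$, an increasing sequence $(m_j)_{j\ge1}$ of positive odd integers and a sequence $(\lambda_j)_{j\ge1}$ of positive numbers with $\sum_{j\ge1}\lambda_j=1$, the Bramson–Kalikow (BK) model is the function $$p(x)=\sum_{j=1}^\infty\lambda_j\,p_{[m_j]}(x),\qquad p_{[m]}(x)=(1-\epsilon)\,\mathbf 1\Big\{x_0\sum_{l=1}^{m}x_{-l}>0\Big\}+\epsilon\,\mathbf 1\Big\{x_0\sum_{l=1}^{m}x_{-l}<0\Big\},\qquad x\in\mathcal X .$$ A probability measure $\mu$ on $\mathcal X$ is compatible with $p$ if it is $T$-invariant and, for each $a\in\{-1,+1\}$, $\mu(\{x_0=a\}\mid T^{-1}\mathcal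 B)(x)=p(a\,Tx)$ for $\mu$-almost every $x$. Let $c\ge 7$ be a real number and $\epsilon=1/4$. For $j\ge1$ let $m_j$ be the largest odd integer not exceeding $2^{cj^2}$. Let $b_1=1$ and $b_l=\big\lceil 2^{(c\sum_{j=1}^{l-1}b_j)^2}\big\rceil$ for $l\ge2$. (If $c$ is an integer, then $m_j=2^{cj^2}-1$ and $b_l=2^{(c\sum_{j=1}^{l-1}b_j)^2}$.) For $l\ge1$ and $j\in\{\sum_{k=1}^{l-1}b_k+1,\dots,\sum_{k=1}^{l}b_k\}$ put $$\lambda_j=\frac{(3/4)^{l-1}}{4\,b_l}.$$ Then $\epsilon$, $(m_j)_{j\ge1}$ and $(\lambda_j)_{j\ge1}$ are parameters of a BK model as above (the $m_j$ are odd and increasing, the $\lambda_j$ are positive with sum $1$), and there are at least two distinct probability measures compatible with the BK model $p$ that they define. -/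

import Mathlib

open MeasureTheory Finset

namespace BramsonKalikow

/-- The space `{-1, +1}^{ℤ₋}` of pasts, with its product topology and product (= Borel) σ-algebra.
The coordinate `x n` is the symbol at time `-n`; the alphabet `{-1, +1}` is `ℤˣ`. -/
abbrev Past : Type := ℕ → ℤˣ

/-- The shift `T`, which forgets the symbol at time `0`. -/
def shift (x : Past) : Past := fun n => x (n + 1)

/-- The concatenation `a x`: the symbol `a` at time `0`, preceded by the past `x`. -/
def concat (a : ℤˣ) (x : Past) : Past
  | 0 => a
  | n + 1 => x n

/-- A probability measure `μ` is compatible with `g` if it is invariant under the shift `T` and the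
conditional probability of `{x₀ = a}` given `T⁻¹ 𝓑` is `g (a x₋₁ x₋₂ …)` almost surely. -/
structure Compatible (g : Past → ℝ) (μ : Measure Past) : Prop where
  isProbabilityMeasure : IsProbabilityMeasure μ
  measurePreserving : MeasurePreserving shift μ μ
  condProb : ∀ a : ℤˣ,
    μ[Set.indicator {x : Past | x 0 = a} (fun _ => (1 : ℝ)) |
        MeasurableSpace.comap shift MeasurableSpace.pi]
      =ᵐ[μ] fun x => g (concat a (shift x))

/-- There are at least two distinct measures compatible with `g`. -/
def HasMultipleCompatible (g : Past → ℝ) : Prop :=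
  ∃ μ ν : Measure Past, Compatible g μ ∧ Compatible g ν ∧ μ ≠ ν

/-- The majority kernel of order `m`: the symbol at time `0` has probability `1 - ε` if it agrees
with the majority of the `m` preceding symbols, and `ε` if it disagrees. -/
noncomputable def majorityKernel (ε : ℝ) (m : ℕ) (x : Past) : ℝ :=
  (if 0 < (x 0 : ℤ) * ∑ l ∈ Icc 1 m, (x l : ℤ) then 1 - ε else 0) +
    (if (x 0 : ℤ) * ∑ l ∈ Icc 1 m, (x l : ℤ) < 0 then ε else 0)

/-- Admissible parameters of the Bramson-Kalikow model (sequences are indexed by `j ≥ 1`; the values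
at `0` play no role). -/
structure IsParameters (ε : ℝ) (lam : ℕ → ℝ) (m : ℕ → ℕ) : Prop where
  eps_pos : 0 < ε
  eps_lt_half : ε < 1 / 2
  odd : ∀ j, 1 ≤ j → Odd (m j)
  increasing : ∀ i j, 1 ≤ i → i < j → m i < m j
  pos : ∀ j, 1 ≤ j → 0 < lam j
  hasSum : HasSum (fun j : ℕ => lam (j + 1)) 1

/-- The function `p = ∑_{j ≥ 1} λ_j p_[m_j]` of the Bramson-Kalikow model. -/
noncomputable def model (ε : ℝ) (lam : ℕ → ℝ) (m : ℕ → ℕ) (x : Past) : ℝ :=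
  ∑' j : ℕ, lam (j + 1) * majorityKernel ε (m (j + 1)) x

end BramsonKalikow

namespace BramsonKalikow

open Filter Topology

/-! `step` averages a function over one newly prepended symbol, so its iterates are the expectations
of a chain that grows a past. Weak limits of time averages from the all-ones past are invariant
(`exists_invariant`), hence compatible (`compatible_of_invariant`). Reversing all signs gives a
second compatible measure. The two differ as soon as, from the all-ones past, some odd-scale
majority is negative with probability at most `C < 1/2` uniformly in time
(`IsParameters.hasMultipleCompatible`).

The uniform bound rests on comparison with truncated chains. Let `R = (3/4)^l` be the weight outside
the first `l` blocks. The next block carries `R/4` of it; declare that block wholly negative and all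
later blocks positive. The resulting chain is attractive, has finite order, and dominates a
sign-symmetric chain in which the weight `R` is split evenly, so its expected symbol from the
all-ones past is at least `R/4` at all positive times. A Doeblin contraction carries this bias over
to every initial past on a time scale `N` exponential in the order, and exponential moments then
make a negative majority at a scale `k` much larger than `N` very unlikely
(`step_iterate_expWeight_le`).

The true chain falls below the truncated one only through negative majorities in the blocks after
the next one. Strong induction on time controls these (`IsBlockModel.step_iterate_negMaj_large_le`),
because the comparison at time `n` uses only earlier times. Each block starts with some scales too
small for the estimate, but the block is so long and its weights so uniform that their share is
negligible (`IsBlockModel.step_iterate_negTail_le`). The first block is a single scale whose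
truncated chain is i.i.d., which gives the final bound `1/4`. -/

/-! ### Transition operator, invariant measures and compatibility. -/

instance : MeasurableSingletonClass ℤˣ where
  measurableSet_singleton u :=
    ⟨{(u : ℤ)}, MeasurableSet.singleton _, by ext v; simp [Units.ext_iff]⟩

instance : BorelSpace ℤˣ where
  measurable_eq := le_antisymm
    (fun s _ => MeasurableSpace.measurableSet_generateFrom (isOpen_discrete s))
    (fun s _ => s.to_countable.measurableSet)

/-- The transition operator of the chain that prepends the symbol `1` to the past `x` with
probability `q x` and the symbol `-1` with probability `1 - q x`. -/
noncomputable def step (q f : Past → ℝ) (x : Past) : ℝ :=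
  q x * f (concat 1 x) + (1 - q x) * f (concat (-1) x)

theorem shift_concat (a : ℤˣ) (x : Past) : shift (concat a x) = x := rfl

theorem continuous_shift : Continuous shift :=
  continuous_pi fun n => continuous_apply (n + 1)

theorem continuous_concat (a : ℤˣ) : Continuous (concat a) := by
  refine continuous_pi fun n => ?_
  cases n with
  | zero => exact continuous_const
  | succ n => exact continuous_apply n

theorem continuous_step {q f : Past → ℝ} (hq : Continuous q) (hf : Continuous f) :
    Continuous (step q f) :=
  (hq.mul (hf.comp (continuous_concat 1))).add
    ((continuous_const.sub hq).mul (hf.comp (continuous_concat (-1))))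

theorem integrable_of_continuous {f : Past → ℝ} (hf : Continuous f) (μ : Measure Past)
    [IsFiniteMeasure μ] : Integrable f μ :=
  (BoundedContinuousFunction.mkOfCompact ⟨f, hf⟩).integrable μ

theorem measure_ext_of_continuous {μ ν : Measure Past} [IsFiniteMeasure μ] [IsFiniteMeasure ν]
    (h : ∀ f : Past → ℝ, Continuous f → ∫ x, f x ∂μ = ∫ x, f x ∂ν) : μ = ν :=
  ext_of_forall_integral_eq_of_IsFiniteMeasure fun f => h f f.continuous

/-- The functional `Λ` on continuous functions is the integral of a probability measure. -/
def IsRepresented (Λ : (Past → ℝ) → ℝ) : Prop :=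
  ∃ μ : Measure Past, IsProbabilityMeasure μ ∧ ∀ f, Continuous f → ∫ x, f x ∂μ = Λ f

theorem isRepresented_eval (x : Past) : IsRepresented fun f => f x :=
  ⟨Measure.dirac x, inferInstance, fun f _ => by simp⟩

theorem IsRepresented.convexComb {Λ₁ Λ₂ : (Past → ℝ) → ℝ} (h₁ : IsRepresented Λ₁)
    (h₂ : IsRepresented Λ₂) {t : ℝ} (h0 : 0 ≤ t) (h1 : t ≤ 1) :
    IsRepresented fun f => t * Λ₁ f + (1 - t) * Λ₂ f := by
  obtain ⟨μ₁, hp₁, h₁⟩ := h₁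
  obtain ⟨μ₂, hp₂, h₂⟩ := h₂
  refine ⟨ENNReal.ofReal t • μ₁ + ENNReal.ofReal (1 - t) • μ₂, ⟨?_⟩, fun f hf => ?_⟩
  · simp only [Measure.coe_add, Measure.coe_smul, Pi.add_apply, Pi.smul_apply, measure_univ,
      smul_eq_mul, mul_one]
    rw [← ENNReal.ofReal_add h0 (by linarith)]
    simp
  · rw [integral_add_measure, integral_smul_measure, integral_smul_measure, h₁ f hf, h₂ f hf,
      ENNReal.toReal_ofReal h0, ENNReal.toReal_ofReal (by linarith)]
    · rfl
    · exact (integrable_of_continuous hf _).smul_measure ENNReal.ofReal_ne_top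
    · exact (integrable_of_continuous hf _).smul_measure ENNReal.ofReal_ne_top

theorem isRepresented_step_iterate {q : Past → ℝ} (h0 : ∀ x, 0 ≤ q x) (h1 : ∀ x, q x ≤ 1) (n : ℕ)
    (x : Past) : IsRepresented fun f => (step q)^[n] f x := by
  induction n generalizing x with
  | zero => exact isRepresented_eval x
  | succ n ih =>
    simp only [Function.iterate_succ_apply']
    exact (ih _).convexComb (ih _) (h0 x) (h1 x)

/-- Time average of the first `n + 1` iterates of the transition operator. -/
noncomputable def timeAverage (q : Past → ℝ) (x : Past) (n : ℕ) (f : Past → ℝ) : ℝ :=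
  (∑ k ∈ range (n + 1), (step q)^[k] f x) / (n + 1)

theorem isRepresented_timeAverage {q : Past → ℝ} (h0 : ∀ x, 0 ≤ q x) (h1 : ∀ x, q x ≤ 1)
    (x : Past) (n : ℕ) : IsRepresented (timeAverage q x n) := by
  induction n with
  | zero => simpa [timeAverage, IsRepresented] using isRepresented_eval x
  | succ n ih =>
    have hn : (0 : ℝ) < n + 1 := by positivity
    -- The average of `n + 2` terms gives the newest term weight `1 / (n + 2)` and the previous
    -- average the rest.
    have := (isRepresented_step_iterate h0 h1 (n + 1) x).convexComb ih
      (t := 1 / (n + 2)) (by positivity) (by rw [div_le_one (by positivity)]; linarith)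
    convert this using 2 with f
    rw [timeAverage, timeAverage, sum_range_succ]
    push_cast
    field_simp
    ring

/-- Krylov–Bogoliubov: the space of probability measures on a compact space is compact, so the time
averages converge along an ultrafilter. Bounds uniform in time survive the limit; this is what later
separates the measures. -/
theorem exists_invariant {q : Past → ℝ} (hq : Continuous q) (h0 : ∀ x, 0 ≤ q x)
    (h1 : ∀ x, q x ≤ 1) (x : Past) :
    ∃ μ : Measure Past, IsProbabilityMeasure μ ∧
      (∀ f, Continuous f → ∫ y, step q f y ∂μ = ∫ y, f y ∂μ) ∧
      ∀ f C, Continuous f → (∀ n, (step q)^[n] f x ≤ C) → ∫ y, f y ∂μ ≤ C := by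
  choose ν hν hνf using isRepresented_timeAverage h0 h1 x
  let P : ℕ → ProbabilityMeasure Past := fun n => ⟨ν n, hν n⟩
  let U : Ultrafilter (ProbabilityMeasure Past) := (hyperfilter ℕ).map P
  have hlim : Tendsto P (hyperfilter ℕ) (𝓝 U.lim) := U.le_nhds_lim
  have hf : ∀ f : Past → ℝ, Continuous f →
      Tendsto (fun n => timeAverage q x n f) (hyperfilter ℕ) (𝓝 (∫ y, f y ∂(U.lim : Measure Past))) := by
    intro f hf
    have := (ProbabilityMeasure.tendsto_iff_forall_integral_tendsto.1 hlim)
      (BoundedContinuousFunction.mkOfCompact ⟨f, hf⟩)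
    refine this.congr fun n => ?_
    exact hνf n f hf
  refine ⟨(U.lim : Measure Past), inferInstance, fun f hc => ?_, fun f C hc hC => ?_⟩
  · have hd := (hf _ (continuous_step hq hc)).sub (hf f hc)
    have hz : Tendsto (fun n => timeAverage q x n (step q f) - timeAverage q x n f)
        (hyperfilter ℕ) (𝓝 0) := by
      refine Tendsto.mono_left ?_ (Nat.hyperfilter_le_atTop)
      obtain ⟨K, hK⟩ : ∃ K, ∀ y, |f y| ≤ K := by
        obtain ⟨K, hK⟩ := isCompact_univ.exists_bound_of_continuousOn hc.continuousOn
        exact ⟨K, fun y => by simpa using hK y (Set.mem_univ y)⟩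
      have hK' : ∀ n, |(step q)^[n] f x| ≤ K := by
        intro n
        obtain ⟨ρ, hρ, hρf⟩ := isRepresented_step_iterate h0 h1 n x
        have hρf := hρf f hc
        simp only at hρf
        rw [← hρf]
        have := norm_integral_le_of_norm_le_const (μ := ρ) (f := f) (C := K)
          (Eventually.of_forall hK)
        simpa using this
      -- The sum telescopes, leaving two bounded terms divided by `n + 1`.
      have heq : ∀ n, timeAverage q x n (step q f) - timeAverage q x n f
          = ((step q)^[n + 1] f x - f x) / (n + 1) := by
        intro n
        rw [timeAverage, timeAverage, ← sub_div]
        congr 1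
        simp only [← Function.iterate_succ_apply]
        rw [← sum_sub_distrib, sum_range_sub (fun k => (step q)^[k] f x)]
        rfl
      have hbd : Tendsto (fun n : ℕ => 2 * K * (1 / ((n : ℝ) + 1))) atTop (𝓝 0) := by
        simpa using tendsto_one_div_add_atTop_nhds_zero_nat.const_mul (2 * K)
      refine squeeze_zero_norm (fun n => ?_) hbd
      rw [heq, Real.norm_eq_abs, abs_div, abs_of_pos (by positivity : (0 : ℝ) < n + 1),
        mul_one_div]
      gcongr
      have := abs_sub ((step q)^[n + 1] f x) (f x)
      linarith [hK' (n + 1), hK x]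
    have := tendsto_nhds_unique hd hz
    linarith
  · refine le_of_tendsto (hf f hc) (Eventually.of_forall fun n => ?_)
    rw [timeAverage, div_le_iff₀ (by positivity)]
    calc _ ≤ ∑ k ∈ range (n + 1), C := sum_le_sum fun k _ => hC k
      _ = _ := by simp; ring

/-- Invariance tested on `1{x₀ = a} · φ(shift x)` says that the image under `shift` of `μ`
restricted to `{x₀ = a}` has density `g (concat a ·)`, which is the conditional probability
statement. With `f ∘ shift` as test function it gives shift invariance. -/
theorem compatible_of_invariant {q g : Past → ℝ} (hq : Continuous q) (h0 : ∀ x, 0 ≤ q x)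
    (h1 : ∀ x, q x ≤ 1) (hg1 : ∀ x, g (concat 1 x) = q x) (hg2 : ∀ x, g (concat (-1) x) = 1 - q x)
    {μ : Measure Past} [IsProbabilityMeasure μ]
    (hμ : ∀ f, Continuous f → ∫ y, step q f y ∂μ = ∫ y, f y ∂μ) : Compatible g μ := by
  have hms : Measurable shift := continuous_shift.measurable
  have hmp : MeasurePreserving shift μ μ := by
    refine ⟨hms, ?_⟩
    have : IsProbabilityMeasure (μ.map shift) := Measure.isProbabilityMeasure_map hms.aemeasurable
    refine measure_ext_of_continuous fun f hf => ?_
    rw [integral_map hms.aemeasurable hf.aestronglyMeasurable]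
    refine (hμ _ (hf.comp continuous_shift)).symm.trans ?_
    refine integral_congr_ae (Eventually.of_forall fun x => ?_)
    simp only [step, Function.comp, shift_concat]
    ring
  refine ⟨inferInstance, hmp, fun a => ?_⟩
  have hgc : Continuous fun x => g (concat a x) := by
    rcases Int.units_eq_one_or a with rfl | rfl
    · simpa only [hg1] using hq
    · simp only [hg2]; exact continuous_const.sub hq
  have hg0 : ∀ x, 0 ≤ g (concat a x) := by
    intro x
    rcases Int.units_eq_one_or a with rfl | rfl
    · rw [hg1]; exact h0 x
    · rw [hg2]; linarith [h1 x]
  have hset : MeasurableSet {x : Past | x 0 = a} :=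
    measurable_pi_apply (X := fun _ : ℕ => ℤˣ) 0 (MeasurableSet.singleton a)
  have hclopen : Continuous ({x : Past | x 0 = a}.indicator fun _ => (1 : ℝ)) := by
    have : Continuous ((fun u : ℤˣ => if u = a then (1 : ℝ) else 0) ∘ fun x : Past => x 0) :=
      continuous_of_discreteTopology.comp (continuous_apply 0)
    convert this using 1
    funext x
    simp [Set.indicator_apply]
  have hstep : ∀ φ : Past → ℝ, ∀ x, step q
      (fun y => {x : Past | x 0 = a}.indicator (fun _ => (1 : ℝ)) y * φ (shift y)) x
        = g (concat a x) * φ x := by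
    intro φ x
    have h10 : ((1 : ℤˣ) = -1) = False := by simp
    have h01 : ((-1 : ℤˣ) = 1) = False := by simp
    simp only [step, shift_concat, Set.indicator_apply, Set.mem_ofPred_eq, concat]
    rcases Int.units_eq_one_or a with rfl | rfl
    · rw [hg1]; simp [h01]
    · rw [hg2]; simp [h10]
  have hkey : (μ.restrict {x : Past | x 0 = a}).map shift
      = μ.withDensity fun x => ENNReal.ofReal (g (concat a x)) := by
    have hfin : IsFiniteMeasure (μ.withDensity fun x => ENNReal.ofReal (g (concat a x))) :=
      isFiniteMeasure_withDensity_ofReal (integrable_of_continuous hgc μ).2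
    refine measure_ext_of_continuous fun φ hφ => ?_
    rw [integral_map hms.aemeasurable hφ.aestronglyMeasurable,
      integral_withDensity_eq_integral_toReal_smul hgc.measurable.ennreal_ofReal (by simp),
      ← integral_indicator hset]
    have := hμ _ (hclopen.mul (hφ.comp continuous_shift))
    calc _ = ∫ x, {x : Past | x 0 = a}.indicator (fun _ => (1 : ℝ)) x * φ (shift x) ∂μ := by
            refine integral_congr_ae (Eventually.of_forall fun x => ?_)
            by_cases hx : x 0 = a <;> simp [hx]
      _ = _ := by
            refine this.symm.trans ?_
            refine integral_congr_ae (Eventually.of_forall fun x => ?_)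
            refine (hstep φ x).trans ?_
            simp only [ smul_eq_mul, ENNReal.toReal_ofReal (hg0 x)]
  have hle : MeasurableSpace.comap shift MeasurableSpace.pi ≤
      (MeasurableSpace.pi : MeasurableSpace Past) := hms.comap_le
  symm
  have hgs : Continuous fun x => g (concat a (shift x)) := hgc.comp continuous_shift
  refine ae_eq_condExp_of_forall_setIntegral_eq hle (integrable_of_continuous hclopen μ)
    (fun s _ _ => (integrable_of_continuous hgs μ).integrableOn) ?_ ?_
  · rintro s ⟨A, hA, rfl⟩ -
    have hA' : MeasurableSet (shift ⁻¹' A) := hms hA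
    calc ∫ x in shift ⁻¹' A, g (concat a (shift x)) ∂μ
        = ∫ x in A, g (concat a x) ∂μ := by
          rw [← setIntegral_map (f := fun x => g (concat a x)) hA hgc.aestronglyMeasurable
            hms.aemeasurable, hmp.map_eq]
      _ = (μ.withDensity fun x => ENNReal.ofReal (g (concat a x))).real A := by
          rw [measureReal_def, withDensity_apply _ hA,
            integral_eq_lintegral_of_nonneg_ae (Eventually.of_forall hg0)
              hgc.aestronglyMeasurable]
      _ = _ := by
          rw [← hkey, measureReal_def, Measure.map_apply hms hA, Measure.restrict_apply hA',
            setIntegral_indicator hset]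
          simp [measureReal_def]
  · refine StronglyMeasurable.aestronglyMeasurable ?_
    exact (hgc.measurable.comp (comap_measurable shift)).stronglyMeasurable


/-! ### Attractive chains and comparison of chains. -/

/-- The pointwise order on pasts, with `-1 ≤ 1`. -/
def Below (x y : Past) : Prop := ∀ n, (x n : ℤ) ≤ (y n : ℤ)

/-- `f` is increasing for the pointwise order on pasts. -/
def Increasing (f : Past → ℝ) : Prop := ∀ x y, Below x y → f x ≤ f y

/-- `f` depends on the first `M` coordinates only. -/
def DependsOnFirst (M : ℕ) (f : Past → ℝ) : Prop :=
  ∀ x y : Past, (∀ i < M, x i = y i) → f x = f y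

/-- The probability `q` of the symbol `1` is a number in `[0, 1]`. -/
def IsProb (q : Past → ℝ) : Prop := ∀ x, 0 ≤ q x ∧ q x ≤ 1

/-- The constant past with symbol `a`. -/
def allEq (a : ℤˣ) : Past := fun _ => a

/-- The value in `ℝ` of the symbol at time `0`. -/
def spin (x : Past) : ℝ := ((x 0 : ℤ) : ℝ)

theorem neg_one_le_unit (u : ℤˣ) : (-1 : ℤ) ≤ u := by
  rcases Int.units_eq_one_or u with rfl | rfl <;> simp

theorem unit_le_one (u : ℤˣ) : (u : ℤ) ≤ 1 := by
  rcases Int.units_eq_one_or u with rfl | rfl <;> simp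

theorem below_allEq_one (x : Past) : Below x (allEq 1) := fun n => unit_le_one (x n)

theorem allEq_neg_one_below (x : Past) : Below (allEq (-1)) x := fun n => by
  simpa [allEq] using neg_one_le_unit (x n)

theorem Below.cons {x y : Past} (h : Below x y) {a b : ℤˣ} (hab : (a : ℤ) ≤ b) :
    Below (concat a x) (concat b y) := by
  intro n
  cases n with
  | zero => exact hab
  | succ n => exact h n

theorem below_refl (x : Past) : Below x x := fun _ => le_rfl

theorem concat_neg_below_concat (x : Past) : Below (concat (-1) x) (concat 1 x) :=
  (below_refl x).cons (by simp)

theorem step_mono {q f g : Past → ℝ} (hq : IsProb q) (h : ∀ x, f x ≤ g x) (x : Past) :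
    step q f x ≤ step q g x := by
  have := hq x
  exact add_le_add (mul_le_mul_of_nonneg_left (h _) this.1)
    (mul_le_mul_of_nonneg_left (h _) (by linarith))

theorem step_iterate_mono {q f g : Past → ℝ} (hq : IsProb q) (n : ℕ) (h : ∀ x, f x ≤ g x)
    (x : Past) : (step q)^[n] f x ≤ (step q)^[n] g x := by
  induction n generalizing f g with
  | zero => exact h x
  | succ n ih =>
    rw [Function.iterate_succ_apply, Function.iterate_succ_apply]
    exact ih (step_mono hq h)

theorem step_const (q : Past → ℝ) (C : ℝ) : step q (fun _ => C) = fun _ => C := by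
  funext x
  simp only [step]
  ring

theorem step_iterate_const (q : Past → ℝ) (n : ℕ) (C : ℝ) :
    (step q)^[n] (fun _ => C) = fun _ => C :=
  Function.iterate_fixed (step_const q C) n

theorem step_iterate_le {q f : Past → ℝ} (hq : IsProb q) (n : ℕ) {C : ℝ} (h : ∀ x, f x ≤ C)
    (x : Past) : (step q)^[n] f x ≤ C := by
  have := step_iterate_mono hq n h x
  rwa [step_iterate_const] at this

theorem le_step_iterate {q f : Past → ℝ} (hq : IsProb q) (n : ℕ) {C : ℝ} (h : ∀ x, C ≤ f x)
    (x : Past) : C ≤ (step q)^[n] f x := by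
  have := step_iterate_mono hq n h x
  rwa [step_iterate_const] at this

theorem step_iterate_add (q : Past → ℝ) (n : ℕ) (f g : Past → ℝ) (x : Past) :
    (step q)^[n] (fun y => f y + g y) x = (step q)^[n] f x + (step q)^[n] g x := by
  induction n generalizing f g x with
  | zero => rfl
  | succ n ih =>
    simp only [Function.iterate_succ_apply', step, ih]
    ring

theorem step_iterate_const_mul (q : Past → ℝ) (n : ℕ) (c : ℝ) (f : Past → ℝ) (x : Past) :
    (step q)^[n] (fun y => c * f y) x = c * (step q)^[n] f x := by
  induction n generalizing f x with
  | zero => rfl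
  | succ n ih =>
    simp only [Function.iterate_succ_apply', step, ih]
    ring

theorem step_iterate_sum {ι : Type*} (q : Past → ℝ) (n : ℕ) (s : Finset ι) (f : ι → Past → ℝ)
    (x : Past) :
    (step q)^[n] (fun y => ∑ i ∈ s, f i y) x = ∑ i ∈ s, (step q)^[n] (f i) x := by
  classical
  induction s using Finset.induction_on with
  | empty => simp [step_iterate_const]
  | insert i s hi ih => simp only [sum_insert hi, step_iterate_add, ih]

theorem step_iterate_hasSum {q : Past → ℝ} (n : ℕ) {f : ℕ → Past → ℝ} {F : Past → ℝ}
    (h : ∀ x, HasSum (fun j => f j x) (F x)) (x : Past) :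
    HasSum (fun j => (step q)^[n] (f j) x) ((step q)^[n] F x) := by
  induction n generalizing x with
  | zero => exact h x
  | succ n ih =>
    simp only [Function.iterate_succ_apply']
    exact ((ih _).mul_left _).add ((ih _).mul_left _)

theorem Increasing.step {q f : Past → ℝ} (hq : IsProb q) (hqm : Increasing q) (hf : Increasing f) :
    Increasing (step q f) := by
  intro x y hxy
  have h1 := hf _ _ (hxy.cons (le_refl ((1 : ℤˣ) : ℤ)))
  have h2 := hf _ _ (hxy.cons (le_refl ((-1 : ℤˣ) : ℤ)))
  have h3 := hf _ _ (concat_neg_below_concat x)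
  have h4 := hqm _ _ hxy
  have h5 := hq y
  simp only [BramsonKalikow.step]
  nlinarith [mul_nonneg (sub_nonneg.2 h4) (sub_nonneg.2 h3), mul_nonneg h5.1 (sub_nonneg.2 h1),
    mul_nonneg (sub_nonneg.2 h5.2) (sub_nonneg.2 h2)]

theorem Increasing.step_iterate {q f : Past → ℝ} (hq : IsProb q) (hqm : Increasing q)
    (hf : Increasing f) (n : ℕ) : Increasing ((BramsonKalikow.step q)^[n] f) := by
  induction n with
  | zero => exact hf
  | succ n ih => rw [Function.iterate_succ_apply']; exact hqm.step hq ih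

/-- Comparison of a chain with an attractive chain whose probability of the symbol `1` is larger
by at most `e`. -/
theorem step_iterate_ge_sub {q q' e f : Past → ℝ} (hq : IsProb q) (hq' : IsProb q')
    (hqm' : Increasing q') (he : ∀ x, 0 ≤ e x) (hqe : ∀ x, q' x - e x ≤ q x) (hf : Increasing f)
    {a : ℝ} (hf0 : ∀ x, a ≤ f x) (hf1 : ∀ x, f x ≤ a + 1) (m : ℕ) (x : Past) :
    (step q')^[m] f x - ∑ i ∈ range m, (step q)^[i] e x ≤ (step q)^[m] f x := by
  induction m generalizing x with
  | zero => simp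
  | succ m ih =>
    set G := (step q')^[m] f with hG
    have hGm : Increasing G := hqm'.step_iterate hq' hf m
    have h0 : ∀ x, a ≤ G x := le_step_iterate hq' m hf0
    have h1 : ∀ x, G x ≤ a + 1 := step_iterate_le hq' m hf1
    -- Lowering the probability of `1` by at most `e x` costs at most `e x` times the increment of
    -- `G` between the two symbols, and that increment lies in `[0, 1]`.
    have hstep : step q' G x - e x ≤ step q G x := by
      have hd := hGm _ _ (concat_neg_below_concat x)
      have := hqe x
      have := he x
      have h3 := h1 (concat 1 x)
      have h4 := h0 (concat (-1) x)
      simp only [step]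
      nlinarith [mul_nonneg (sub_nonneg.2 (hqe x)) (sub_nonneg.2 hd),
        mul_nonneg (he x) (by linarith : 0 ≤ 1 - (G (concat 1 x) - G (concat (-1) x)))]
    have hmono : step q (fun y => G y - ∑ i ∈ range m, (step q)^[i] e y) x
        ≤ step q ((step q)^[m] f) x := step_mono hq ih x
    have hlin : step q (fun y => G y - ∑ i ∈ range m, (step q)^[i] e y) x
        = step q G x - ∑ i ∈ range m, (step q)^[i + 1] e x := by
      simp only [Function.iterate_succ_apply', step]
      rw [sum_add_distrib, ← mul_sum, ← mul_sum]
      ring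
    rw [Function.iterate_succ_apply', Function.iterate_succ_apply', sum_range_succ']
    simp only [Function.iterate_zero, id]
    linarith

theorem step_iterate_le_of_le {q q' f : Past → ℝ} (hq : IsProb q) (hq' : IsProb q')
    (hqm' : Increasing q') (hqe : ∀ x, q' x ≤ q x) (hf : Increasing f)
    {a : ℝ} (hf0 : ∀ x, a ≤ f x) (hf1 : ∀ x, f x ≤ a + 1) (m : ℕ) (x : Past) :
    (step q')^[m] f x ≤ (step q)^[m] f x := by
  have := step_iterate_ge_sub hq hq' hqm' (e := fun _ => 0) (fun _ => le_rfl)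
    (by simpa using hqe) hf hf0 hf1 m x
  simpa [step_iterate_const] using this

/-- From the largest past, the expectation of an increasing function decreases with time. -/
theorem step_iterate_allEq_one_anti {q f : Past → ℝ} (hq : IsProb q) (hqm : Increasing q)
    (hf : Increasing f) {m n : ℕ}
    (hmn : m ≤ n) : (step q)^[n] f (allEq 1) ≤ (step q)^[m] f (allEq 1) := by
  obtain ⟨k, rfl⟩ := Nat.exists_eq_add_of_le' hmn
  rw [Function.iterate_add_apply]
  exact step_iterate_le hq k (fun x => hqm.step_iterate hq hf m _ _ (below_allEq_one x)) _

/-- After `n` symbols are prepended, `shift^[n]` recovers the initial past, so a factor reading only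
that past is a known constant. This is the Markov property used below. -/
theorem step_iterate_mul_shift (q : Past → ℝ) (n : ℕ) (f g : Past → ℝ) (x : Past) :
    (step q)^[n] (fun y => f y * g (shift^[n] y)) x = g x * (step q)^[n] f x := by
  induction n generalizing g x with
  | zero => simp [mul_comm]
  | succ n ih =>
    rw [Function.iterate_succ_apply', Function.iterate_succ_apply']
    have : (step q)^[n] (fun y => f y * g (shift^[n + 1] y))
        = fun x => g (shift x) * (step q)^[n] f x := by
      funext x
      rw [← ih (fun z => g (shift z)) x]
      simp only [Function.iterate_succ_apply']
    rw [this]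
    simp only [step, shift_concat]
    ring

/-! ### Loss of memory for chains of finite order. -/

theorem DependsOnFirst.step {q f : Past → ℝ} {M : ℕ} (hq : DependsOnFirst M q)
    (hf : DependsOnFirst M f) : DependsOnFirst M (step q f) := by
  intro x y hxy
  have h : ∀ a, f (BramsonKalikow.concat a x) = f (BramsonKalikow.concat a y) := by
    intro a
    refine hf _ _ fun i hi => ?_
    cases i with
    | zero => rfl
    | succ i => exact hxy i (by omega)
  simp only [BramsonKalikow.step, h, hq x y hxy]

theorem DependsOnFirst.step_iterate {q f : Past → ℝ} {M : ℕ} (hq : DependsOnFirst M q)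
    (hf : DependsOnFirst M f) (n : ℕ) : DependsOnFirst M ((BramsonKalikow.step q)^[n] f) := by
  induction n with
  | zero => exact hf
  | succ n ih => rw [Function.iterate_succ_apply']; exact hq.step ih

/-- Doeblin minorization by the event that `k` consecutive symbols are `1`. -/
theorem step_iterate_minorization {q f : Past → ℝ} (hq : IsProb q) {ρ : ℝ} (hρ : 0 ≤ ρ)
    (hρq : ∀ x, ρ ≤ q x) {L : ℝ} (hL : ∀ x, L ≤ f x) (k : ℕ) (x : Past) :
    ρ ^ k * f ((concat 1)^[k] x) + (1 - ρ ^ k) * L ≤ (step q)^[k] f x := by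
  induction k generalizing x with
  | zero => simp
  | succ k ih =>
    rw [Function.iterate_succ_apply' (step q), Function.iterate_succ_apply (concat 1)]
    have h1 := ih (concat 1 x)
    have h2 : L ≤ (step q)^[k] f (concat (-1) x) := le_step_iterate hq k hL _
    have h3 := hq x
    have h4 := mul_le_mul_of_nonneg_left h1 h3.1
    have h5 := mul_le_mul_of_nonneg_left h2 (by linarith : 0 ≤ 1 - q x)
    have h6 : 0 ≤ (q x - ρ) * (ρ ^ k * (f ((concat 1)^[k] (concat 1 x)) - L)) :=
      mul_nonneg (sub_nonneg.2 (hρq x)) (mul_nonneg (pow_nonneg hρ k) (sub_nonneg.2 (hL _)))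
    simp only [step]
    rw [pow_succ]
    nlinarith

theorem iterate_concat_one_apply (k : ℕ) (x : Past) {i : ℕ} (hi : i < k) :
    (concat 1)^[k] x i = 1 := by
  induction k generalizing i with
  | zero => omega
  | succ k ih =>
    rw [Function.iterate_succ_apply']
    cases i with
    | zero => rfl
    | succ i => exact ih (by omega)

theorem increasing_spin : Increasing spin := fun x y h => by
  simpa [spin] using h 0

theorem spin_le_one (x : Past) : spin x ≤ 1 := by
  have := unit_le_one (x 0)
  simp only [spin]; exact_mod_cast this

theorem neg_one_le_spin (x : Past) : -1 ≤ spin x := by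
  have := neg_one_le_unit (x 0)
  simp only [spin]; exact_mod_cast this

/-- The gap at time `n` between the expected symbols from the largest and the smallest past. -/
noncomputable def spinGap (q : Past → ℝ) (n : ℕ) : ℝ :=
  (step q)^[n] spin (allEq 1) - (step q)^[n] spin (allEq (-1))

/-- A run of `M` ones, of probability at least `ρ ^ M`, erases the memory of a chain of order `M`.
The gap between the extreme pasts thus contracts by `1 - ρ ^ M` every `M` steps and is summable. -/
theorem sum_spinGap_le {q : Past → ℝ} (hq : IsProb q) (hqm : Increasing q) {ρ : ℝ} (hρ : 0 < ρ)
    (hρq : ∀ x, ρ ≤ q x) {M : ℕ} (hM : 1 ≤ M) (hqM : DependsOnFirst M q) (N : ℕ) :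
    ∑ n ∈ range N, spinGap q n ≤ 2 * M / ρ ^ M := by
  have hnn : ∀ n, 0 ≤ spinGap q n := fun n =>
    sub_nonneg.2 (hqm.step_iterate hq increasing_spin n _ _ (below_allEq_one _))
  have h2 : ∀ n, spinGap q n ≤ 2 := fun n => by
    have h1 := step_iterate_le hq n spin_le_one (allEq 1)
    have h2 := le_step_iterate hq n neg_one_le_spin (allEq (-1))
    simp only [spinGap]; linarith
  have hdep : DependsOnFirst M spin := fun x y h => by simp [spin, h 0 (by omega)]
  have hcontr : ∀ n, spinGap q (M + n) ≤ (1 - ρ ^ M) * spinGap q n := by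
    intro n
    set f := (step q)^[n] spin with hf
    have hfm : Increasing f := hqm.step_iterate hq increasing_spin n
    have hfd : DependsOnFirst M f := hqM.step_iterate hdep n
    have h1 : (step q)^[M] f (allEq 1) ≤ f (allEq 1) :=
      step_iterate_le hq M (fun x => hfm _ _ (below_allEq_one x)) _
    have h3 := step_iterate_minorization hq hρ.le hρq (fun x => hfm _ _ (allEq_neg_one_below x)) M
      (allEq (-1))
    have h4 : f ((concat 1)^[M] (allEq (-1))) = f (allEq 1) :=
      hfd _ _ fun i hi => by rw [iterate_concat_one_apply _ _ hi]; rfl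
    rw [h4] at h3
    simp only [spinGap, Function.iterate_add_apply, ← hf]
    linarith
  have hρM : 0 < ρ ^ M := pow_pos hρ M
  rw [le_div_iff₀ hρM]
  have hsplit := sum_range_add (fun n => spinGap q n) M N
  have hle : ∑ n ∈ range N, spinGap q (M + n) ≤ (1 - ρ ^ M) * ∑ n ∈ range N, spinGap q n := by
    rw [mul_sum]; exact sum_le_sum fun n _ => hcontr n
  have hM2 : ∑ n ∈ range M, spinGap q n ≤ 2 * M := by
    calc _ ≤ ∑ n ∈ range M, (2 : ℝ) := sum_le_sum fun n _ => h2 n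
      _ = _ := by simp [mul_comm]
  have hmon : ∑ n ∈ range N, spinGap q n ≤ ∑ n ∈ range (M + N), spinGap q n :=
    sum_le_sum_of_subset_of_nonneg (range_mono (by omega)) fun n _ _ => hnn n
  -- With `S` the sum up to `N`, the bounds give `S ≤ 2M + (1 - ρ ^ M) S`.
  linarith

/-! ### Exponential moments of sums of symbols. -/

/-- Sum of the first `m` symbols. -/
def spinSum (m : ℕ) (x : Past) : ℤ := ∑ i ∈ range m, (x i : ℤ)

/-- Exponential weight of the sum of the first `m` symbols. -/
noncomputable def expWeight (s : ℝ) (m : ℕ) (x : Past) : ℝ := Real.exp (-s * spinSum m x)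

theorem shift_iterate_apply (n : ℕ) (x : Past) (i : ℕ) : shift^[n] x i = x (n + i) := by
  induction n generalizing x with
  | zero => simp
  | succ n ih => rw [Function.iterate_succ_apply, ih]; simp [shift]; congr 1; omega

theorem spinSum_add (m n : ℕ) (x : Past) :
    spinSum (m + n) x = spinSum m x + spinSum n (shift^[m] x) := by
  simp only [spinSum, sum_range_add, shift_iterate_apply]

theorem expWeight_add (s : ℝ) (m n : ℕ) (x : Past) :
    expWeight s (m + n) x = expWeight s m x * expWeight s n (shift^[m] x) := by
  rw [expWeight, expWeight, expWeight, ← Real.exp_add, spinSum_add]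
  push_cast
  ring_nf

theorem expWeight_pos (s : ℝ) (m : ℕ) (x : Past) : 0 < expWeight s m x := Real.exp_pos _

/-- The weight factors over consecutive stretches of time. Conditioning on the earlier stretch,
bounds uniform in the past multiply. -/
theorem step_iterate_expWeight_add_le {q : Past → ℝ} (hq : IsProb q) (s : ℝ) {m n : ℕ} {C D : ℝ}
    (hC0 : 0 ≤ C) (hC : ∀ x, (step q)^[m] (expWeight s m) x ≤ C)
    (hD : ∀ x, (step q)^[n] (expWeight s n) x ≤ D) (x : Past) :
    (step q)^[m + n] (expWeight s (m + n)) x ≤ C * D := by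
  have h1 : (step q)^[m] (expWeight s (m + n))
      = fun x => expWeight s n x * (step q)^[m] (expWeight s m) x := by
    funext x
    rw [← step_iterate_mul_shift]
    exact congrArg (fun F => (step q)^[m] F x) (funext fun y => expWeight_add s m n y)
  rw [add_comm m n, Function.iterate_add_apply, add_comm n m, h1]
  calc _ ≤ (step q)^[n] (fun y => C * expWeight s n y) x := by
        refine step_iterate_mono hq n (fun y => ?_) x
        rw [mul_comm]
        exact mul_le_mul_of_nonneg_right (hC y) (expWeight_pos _ _ _).le
    _ = C * (step q)^[n] (expWeight s n) x := step_iterate_const_mul ..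
    _ ≤ _ := mul_le_mul_of_nonneg_left (hD x) hC0

theorem step_iterate_expWeight_mul_le {q : Past → ℝ} (hq : IsProb q) (s : ℝ) {N : ℕ} {C : ℝ}
    (hC0 : 0 ≤ C) (hC : ∀ x, (step q)^[N] (expWeight s N) x ≤ C) (k : ℕ) (x : Past) :
    (step q)^[N * k] (expWeight s (N * k)) x ≤ C ^ k := by
  induction k generalizing x with
  | zero => simp [expWeight, spinSum]
  | succ k ih =>
    rw [mul_add, mul_one, pow_succ]
    exact step_iterate_expWeight_add_le hq s (pow_nonneg hC0 k) ih hC x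

theorem abs_spinSum_le (m : ℕ) (x : Past) : |(spinSum m x : ℝ)| ≤ m := by
  have : |spinSum m x| ≤ m := by
    refine (abs_sum_le_sum_abs _ _).trans ((sum_le_card_nsmul _ _ 1 fun i _ => ?_).trans (by simp))
    exact abs_le.2 ⟨neg_one_le_unit _, unit_le_one _⟩
  exact_mod_cast this

theorem step_iterate_spinSum (q : Past → ℝ) (N : ℕ) (x : Past) :
    (step q)^[N] (fun y => (spinSum N y : ℝ)) x = ∑ i ∈ range N, (step q)^[i + 1] spin x := by
  have h1 : (fun y : Past => (spinSum N y : ℝ)) = fun y => ∑ i ∈ range N, spin (shift^[i] y) := by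
    funext y
    simp [spinSum, spin, shift_iterate_apply]
  rw [h1, step_iterate_sum, ← sum_range_reflect]
  refine sum_congr rfl fun i hi => ?_
  have hi := mem_range.1 hi
  have h2 : (step q)^[N - 1 - i] (fun y => spin (shift^[N - 1 - i] y)) = spin := by
    funext y
    have := step_iterate_mul_shift q (N - 1 - i) (fun _ => 1) spin y
    simpa [step_iterate_const] using this
  have h3 : (step q)^[N] = (step q)^[(i + 1) + (N - 1 - i)] := by congr 1; omega
  rw [h3, Function.iterate_add_apply, h2]

/-- An attractive chain of finite order whose expected symbol from the largest past stays above `r`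
satisfies an exponential bound for the sums of its symbols. -/
theorem step_iterate_expWeight_le {q : Past → ℝ} (hq : IsProb q) (hqm : Increasing q) {ρ : ℝ}
    (hρ : 0 < ρ) (hρq : ∀ x, ρ ≤ q x) {M : ℕ} (hM : 1 ≤ M) (hqM : DependsOnFirst M q) {r : ℝ}
    (hr0 : 0 < r) (hr1 : r ≤ 1)
    (hr : ∀ n, r ≤ (step q)^[n + 1] spin (allEq 1)) {N : ℕ} (hN : 4 * M / ρ ^ M ≤ r * N)
    (m : ℕ) (x : Past) :
    (step q)^[m] (expWeight (r / (4 * N)) m) x ≤ 3 * (1 - r ^ 2 / 16) ^ (m / N) := by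
  have hρM : 0 < ρ ^ M := pow_pos hρ M
  have hM0 : (0 : ℝ) < M := by exact_mod_cast hM
  have hN0 : 0 < N := by
    rcases Nat.eq_zero_or_pos N with rfl | h
    · have : 0 < 4 * M / ρ ^ M := by positivity
      simp at hN; linarith
    · exact h
  have hN0' : (0 : ℝ) < N := by exact_mod_cast hN0
  set s : ℝ := r / (4 * N) with hs
  have hs0 : 0 ≤ s := by positivity
  have hsN : s * N = r / 4 := by rw [hs]; field_simp
  have hbd : ∀ k ≤ N, ∀ y, |-s * (spinSum k y : ℝ)| ≤ r / 4 := by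
    intro k hk y
    rw [abs_mul, abs_neg, abs_of_nonneg hs0, ← hsN]
    have : (k : ℝ) ≤ N := by exact_mod_cast hk
    exact mul_le_mul_of_nonneg_left ((abs_spinSum_le k y).trans this) hs0
  -- From the all-ones past the mean is at least `r * N`; any other past loses at most the summed
  -- gap `2M / ρ ^ M ≤ r * N / 2`.
  have hsum : ∀ y, r * N / 2 ≤ (step q)^[N] (fun y => (spinSum N y : ℝ)) y := by
    intro y
    rw [step_iterate_spinSum]
    have h1 : ∀ i ∈ range N, r - spinGap q (i + 1) ≤ (step q)^[i + 1] spin y := by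
      intro i _
      have := hr i
      have := hqm.step_iterate hq increasing_spin (i + 1) _ _ (allEq_neg_one_below y)
      simp only [spinGap]; linarith
    have h2 := sum_le_sum h1
    have h3 := sum_spinGap_le hq hqm hρ hρq hM hqM (N + 1)
    rw [sum_range_succ'] at h3
    have h4 : 0 ≤ spinGap q 0 := by simp [spinGap, spin, allEq]
    rw [sum_sub_distrib, sum_const, card_range, nsmul_eq_mul] at h2
    have h5 : 4 * M / ρ ^ M = 2 * (2 * M / ρ ^ M) := by ring
    linarith
  -- Since `s * N = r / 4`, the inequality `exp t ≤ 1 + t + t²` for `|t| ≤ 1` leaves `1 + r² / 16 -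
  -- r² / 8`.
  have hblock : ∀ y, (step q)^[N] (expWeight s N) y ≤ 1 - r ^ 2 / 16 := by
    intro y
    have h1 : ∀ z, expWeight s N z ≤ (1 + r ^ 2 / 16) + -s * (spinSum N z : ℝ) := by
      intro z
      have hb := hbd N le_rfl z
      have := Real.abs_exp_sub_one_sub_id_le (hb.trans (by linarith))
      have h2 := (abs_le.1 this).2
      have h3 : (-s * (spinSum N z : ℝ)) ^ 2 ≤ (r / 4) ^ 2 := sq_le_sq' (by
        linarith [(abs_le.1 hb).1]) (abs_le.1 hb).2
      simp only [expWeight]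
      linarith
    have h2 := step_iterate_mono hq N h1 y
    rw [step_iterate_add, step_iterate_const_mul, step_iterate_const] at h2
    have h3 := mul_le_mul_of_nonneg_left (hsum y) hs0
    have h4 : s * (r * N / 2) = r ^ 2 / 8 := by
      rw [show s * (r * N / 2) = (s * N) * r / 2 by ring, hsN]; ring
    linarith
  have hC0 : 0 ≤ 1 - r ^ 2 / 16 := by nlinarith
  -- The incomplete last block of length `m % N` costs at most a factor `e < 3`.
  have hrem : ∀ y, (step q)^[m % N] (expWeight s (m % N)) y ≤ 3 := by
    refine step_iterate_le hq _ fun y => ?_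
    have h1 := (abs_le.1 (hbd (m % N) (Nat.mod_lt m hN0).le y)).2
    calc expWeight s (m % N) y ≤ Real.exp 1 := Real.exp_le_exp.2 (by linarith)
      _ ≤ 3 := by linarith [Real.exp_one_lt_d9]
  have := step_iterate_expWeight_add_le hq s (pow_nonneg hC0 (m / N))
    (step_iterate_expWeight_mul_le hq s hC0 hblock (m / N)) hrem x
  rw [Nat.div_add_mod] at this
  linarith



/-! ### Sign reversal and negative majorities. -/

/-- The past with all symbols reversed. -/
def flip (x : Past) : Past := fun n => -x n

theorem flip_concat (a : ℤˣ) (x : Past) : flip (concat a x) = concat (-a) (flip x) := by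
  funext n
  cases n <;> rfl

theorem continuous_flip : Continuous flip :=
  continuous_pi fun n => continuous_of_discreteTopology.comp (continuous_apply n)

theorem step_comp_flip {q : Past → ℝ} (hq : ∀ x, q (flip x) = 1 - q x) (f : Past → ℝ) (x : Past) :
    step q (fun y => f (flip y)) x = step q f (flip x) := by
  simp only [step, flip_concat, hq, neg_neg]
  ring

theorem step_iterate_odd {q : Past → ℝ} (hq : ∀ x, q (flip x) = 1 - q x) {f : Past → ℝ}
    (hf : ∀ x, f (flip x) = -f x) (n : ℕ) (x : Past) :
    (step q)^[n] f (flip x) = -(step q)^[n] f x := by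
  induction n generalizing x with
  | zero => exact hf x
  | succ n ih =>
    rw [Function.iterate_succ_apply', ← step_comp_flip hq]
    simp only [ih, step]
    ring

/-- In a symmetric attractive chain started from the largest past, an increasing odd function has
nonnegative expectation. -/
theorem step_iterate_odd_nonneg {q : Past → ℝ} (hp : IsProb q) (hqm : Increasing q)
    (hq : ∀ x, q (flip x) = 1 - q x) {f : Past → ℝ} (hfm : Increasing f)
    (hf : ∀ x, f (flip x) = -f x) (n : ℕ) : 0 ≤ (step q)^[n] f (allEq 1) := by
  have h1 := step_iterate_odd hq hf n (allEq 1)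
  have h2 := hqm.step_iterate hp hfm n _ _ (below_allEq_one (flip (allEq 1)))
  linarith

/-- Indicator that the sum of the first `m` symbols is negative. -/
noncomputable def negMaj (m : ℕ) (x : Past) : ℝ := if spinSum m x < 0 then 1 else 0

theorem negMaj_nonneg (m : ℕ) (x : Past) : 0 ≤ negMaj m x := by
  unfold negMaj; split_ifs <;> norm_num

theorem negMaj_le_one (m : ℕ) (x : Past) : negMaj m x ≤ 1 := by
  unfold negMaj; split_ifs <;> norm_num

theorem spinSum_mono (m : ℕ) {x y : Past} (h : Below x y) : spinSum m x ≤ spinSum m y :=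
  sum_le_sum fun i _ => h i

theorem negMaj_anti (m : ℕ) {x y : Past} (h : Below x y) : negMaj m y ≤ negMaj m x := by
  have := spinSum_mono m h
  unfold negMaj
  split_ifs <;> first | omega | norm_num

theorem spinSum_flip (m : ℕ) (x : Past) : spinSum m (flip x) = -spinSum m x := by
  simp [spinSum, flip]

theorem spinSum_emod_two (m : ℕ) (x : Past) : spinSum m x % 2 = m % 2 := by
  induction m with
  | zero => simp [spinSum]
  | succ m ih =>
    have hs : spinSum (m + 1) x = spinSum m x + (x m : ℤ) := sum_range_succ _ _
    rw [hs]
    rcases Int.units_eq_one_or (x m) with h | h <;> rw [h] <;> push_cast <;> omega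

theorem spinSum_ne_zero {m : ℕ} (hm : Odd m) (x : Past) : spinSum m x ≠ 0 := by
  obtain ⟨k, rfl⟩ := hm
  have := spinSum_emod_two (2 * k + 1) x
  push_cast at this
  omega

theorem negMaj_flip {m : ℕ} (hm : Odd m) (x : Past) : negMaj m (flip x) = 1 - negMaj m x := by
  have := spinSum_ne_zero hm x
  unfold negMaj
  rw [spinSum_flip]
  split_ifs <;> first | omega | norm_num

theorem negMaj_le_expWeight {s : ℝ} (hs : 0 ≤ s) (m : ℕ) (x : Past) :
    negMaj m x ≤ expWeight s m x := by
  unfold negMaj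
  split_ifs with h
  · have h' : (spinSum m x : ℝ) ≤ 0 := by exact_mod_cast h.le
    exact Real.one_le_exp (by nlinarith)
  · exact (expWeight_pos _ _ _).le

theorem continuous_negMaj (m : ℕ) : Continuous (negMaj m) := by
  have h : Continuous (spinSum m) :=
    continuous_finsetSum _ fun i _ => continuous_of_discreteTopology.comp (continuous_apply i)
  exact (continuous_of_discreteTopology (f := fun k : ℤ => if k < 0 then (1 : ℝ) else 0)).comp h

theorem dependsOnFirst_negMaj {m M : ℕ} (h : m ≤ M) : DependsOnFirst M (negMaj m) := by
  intro x y hxy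
  have : spinSum m x = spinSum m y :=
    sum_congr rfl fun i hi => by rw [hxy i ((mem_range.1 hi).trans_le h)]
  simp [negMaj, this]

theorem spinSum_eq_sum_concat (a : ℤˣ) (m : ℕ) (x : Past) :
    ∑ l ∈ Icc 1 m, ((concat a x) l : ℤ) = spinSum m x := by
  induction m with
  | zero => simp [spinSum]
  | succ m ih =>
    rw [sum_Icc_succ_top (by omega), ih, spinSum, spinSum, sum_range_succ]
    rfl

theorem majorityKernel_concat_one {m : ℕ} (hm : Odd m) (x : Past) :
    majorityKernel (1 / 4) m (concat 1 x) = 3 / 4 - negMaj m x / 2 := by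
  have := spinSum_ne_zero hm x
  rw [majorityKernel, spinSum_eq_sum_concat]
  simp only [concat, negMaj, Units.val_one, one_mul]
  split_ifs <;> first | omega | norm_num

theorem majorityKernel_concat_neg_one {m : ℕ} (hm : Odd m) (x : Past) :
    majorityKernel (1 / 4) m (concat (-1) x) = 1 / 4 + negMaj m x / 2 := by
  have := spinSum_ne_zero hm x
  rw [majorityKernel, spinSum_eq_sum_concat]
  simp only [concat, negMaj, Units.val_neg, Units.val_one, neg_mul, one_mul]
  split_ifs <;> first | omega | norm_num

/-! ### The model, its truncations and the criterion for two measures. -/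

/-- The probability of the symbol `1` in the model with `ε = 1 / 4`. -/
noncomputable def plusProb (lam : ℕ → ℝ) (m : ℕ → ℕ) (x : Past) : ℝ :=
  3 / 4 - (∑' j : ℕ, lam (j + 1) * negMaj (m (j + 1)) x) / 2

/-- The weight of the scales beyond `J` whose majority is negative. -/
noncomputable def negTail (lam : ℕ → ℝ) (m : ℕ → ℕ) (J : ℕ) (x : Past) : ℝ :=
  ∑' j : ℕ, lam (J + j + 1) * negMaj (m (J + j + 1)) x

/-- The probability of the symbol `1` when the majority is followed at the scales up to `J`, a
weight `r` is negative and the remaining weight is positive. -/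
noncomputable def truncProb (lam : ℕ → ℝ) (m : ℕ → ℕ) (J : ℕ) (r : ℝ) (x : Past) : ℝ :=
  3 / 4 - (∑ j ∈ range J, lam (j + 1) * negMaj (m (j + 1)) x + r) / 2

section Parameters

variable {ε : ℝ} {lam : ℕ → ℝ} {m : ℕ → ℕ}

theorem IsParameters.lam_nonneg (h : IsParameters ε lam m) (j : ℕ) : 0 ≤ lam (j + 1) :=
  (h.pos _ (by omega)).le

theorem IsParameters.summable_negMaj (h : IsParameters ε lam m) (x : Past) :
    Summable fun j => lam (j + 1) * negMaj (m (j + 1)) x :=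
  h.hasSum.summable.of_nonneg_of_le
    (fun j => mul_nonneg (h.lam_nonneg j) (negMaj_nonneg _ _))
    (fun j => mul_le_of_le_one_right (h.lam_nonneg j) (negMaj_le_one _ _))

theorem IsParameters.summable_negTail (h : IsParameters ε lam m) (J : ℕ) (x : Past) :
    Summable fun j => lam (J + j + 1) * negMaj (m (J + j + 1)) x := by
  have := (summable_nat_add_iff J).2 (h.summable_negMaj x)
  simpa only [add_comm _ J] using this

theorem IsParameters.negTail_nonneg (h : IsParameters ε lam m) (J : ℕ) (x : Past) :
    0 ≤ negTail lam m J x :=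
  tsum_nonneg fun _ => mul_nonneg (h.lam_nonneg _) (negMaj_nonneg _ _)

theorem IsParameters.sum_add_negTail (h : IsParameters ε lam m) (J : ℕ) (x : Past) :
    ∑ j ∈ range J, lam (j + 1) * negMaj (m (j + 1)) x + negTail lam m J x
      = ∑' j : ℕ, lam (j + 1) * negMaj (m (j + 1)) x := by
  rw [← (h.summable_negMaj x).sum_add_tsum_nat_add J, negTail]
  simp only [add_comm _ J]

theorem IsParameters.isProb_plusProb (h : IsParameters ε lam m) : IsProb (plusProb lam m) := by
  intro x
  have h0 : 0 ≤ ∑' j : ℕ, lam (j + 1) * negMaj (m (j + 1)) x :=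
    tsum_nonneg fun _ => mul_nonneg (h.lam_nonneg _) (negMaj_nonneg _ _)
  have h1 : ∑' j : ℕ, lam (j + 1) * negMaj (m (j + 1)) x ≤ 1 := by
    rw [← h.hasSum.tsum_eq]
    exact (h.summable_negMaj x).tsum_le_tsum
      (fun j => mul_le_of_le_one_right (h.lam_nonneg j) (negMaj_le_one _ _)) h.hasSum.summable
  constructor <;> simp only [plusProb] <;> linarith

theorem IsParameters.continuous_plusProb (h : IsParameters ε lam m) :
    Continuous (plusProb lam m) := by
  refine continuous_const.sub (Continuous.div_const ?_ 2)
  refine continuous_tsum (fun j => continuous_const.mul (continuous_negMaj _)) h.hasSum.summable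
    fun j x => ?_
  rw [Real.norm_of_nonneg (mul_nonneg (h.lam_nonneg _) (negMaj_nonneg _ _))]
  exact mul_le_of_le_one_right (h.lam_nonneg j) (negMaj_le_one _ _)

theorem IsParameters.plusProb_flip (h : IsParameters ε lam m) (x : Past) :
    plusProb lam m (flip x) = 1 - plusProb lam m x := by
  have : ∑' j : ℕ, lam (j + 1) * negMaj (m (j + 1)) (flip x)
      = 1 - ∑' j : ℕ, lam (j + 1) * negMaj (m (j + 1)) x := by
    have h1 := h.hasSum.sub (h.summable_negMaj x).hasSum
    rw [← h1.tsum_eq]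
    refine tsum_congr fun j => ?_
    rw [negMaj_flip (h.odd _ (by omega))]
    ring
  simp only [plusProb, this]
  ring

theorem IsParameters.model_concat_one (h : IsParameters ε lam m) (x : Past) :
    model (1 / 4) lam m (concat 1 x) = plusProb lam m x := by
  have h1 := (h.hasSum.mul_left (3 / 4)).sub ((h.summable_negMaj x).hasSum.div_const 2)
  rw [mul_one] at h1
  rw [model, plusProb, ← h1.tsum_eq]
  refine tsum_congr fun j => ?_
  rw [majorityKernel_concat_one (h.odd _ (by omega))]
  ring

theorem IsParameters.model_concat_neg_one (h : IsParameters ε lam m) (x : Past) :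
    model (1 / 4) lam m (concat (-1) x) = 1 - plusProb lam m x := by
  have h1 := (h.hasSum.mul_left (1 / 4)).add ((h.summable_negMaj x).hasSum.div_const 2)
  rw [mul_one] at h1
  have h2 : 1 - plusProb lam m x
      = 1 / 4 + (∑' j : ℕ, lam (j + 1) * negMaj (m (j + 1)) x) / 2 := by
    rw [plusProb]; ring
  rw [model, h2, ← h1.tsum_eq]
  refine tsum_congr fun j => ?_
  rw [majorityKernel_concat_neg_one (h.odd _ (by omega))]
  ring

/-- If, in the chain started from the largest past, the majority at some scale is negative with
probability bounded away from `1 / 2`, then there are two compatible measures. -/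
theorem IsParameters.hasMultipleCompatible (h : IsParameters ε lam m) {k : ℕ} (hk : Odd k) {C : ℝ}
    (hC : C < 1 / 2) (hle : ∀ n, (step (plusProb lam m))^[n] (negMaj k) (allEq 1) ≤ C) :
    HasMultipleCompatible (model (1 / 4) lam m) := by
  have hp := h.isProb_plusProb
  have hc := h.continuous_plusProb
  obtain ⟨μ, hμ, hinv, hbd⟩ :=
    exists_invariant hc (fun x => (hp x).1) (fun x => (hp x).2) (allEq 1)
  have hmeas := continuous_flip.measurable
  have hν : IsProbabilityMeasure (μ.map flip) := Measure.isProbabilityMeasure_map hmeas.aemeasurable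
  have hint : ∀ f : Past → ℝ, Continuous f → ∫ x, f x ∂(μ.map flip) = ∫ x, f (flip x) ∂μ :=
    fun f hf => integral_map hmeas.aemeasurable hf.aestronglyMeasurable
  refine ⟨μ, μ.map flip,
    compatible_of_invariant hc (fun x => (hp x).1) (fun x => (hp x).2) h.model_concat_one
      h.model_concat_neg_one hinv,
    compatible_of_invariant hc (fun x => (hp x).1) (fun x => (hp x).2) h.model_concat_one
      h.model_concat_neg_one fun f hf => ?_, fun heq => ?_⟩
  · rw [hint _ (continuous_step hc hf), hint f hf]
    refine Eq.trans ?_ (hinv _ (hf.comp continuous_flip))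
    exact integral_congr_ae (Eventually.of_forall fun x =>
      (step_comp_flip h.plusProb_flip f x).symm)
  -- If the measures agreed, the integral of `negMaj k` would equal one minus itself, hence `1 / 2`,
  -- which exceeds `C`.
  · have h1 := hint (negMaj k) (continuous_negMaj k)
    rw [← heq] at h1
    simp only [negMaj_flip hk] at h1
    rw [integral_sub (integrable_const _) (integrable_of_continuous (continuous_negMaj k) μ)] at h1
    have h2 := hbd _ C (continuous_negMaj k) hle
    simp at h1
    linarith

theorem IsParameters.sum_mul_negMaj_nonneg (h : IsParameters ε lam m) (J : ℕ) (x : Past) :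
    0 ≤ ∑ j ∈ range J, lam (j + 1) * negMaj (m (j + 1)) x :=
  sum_nonneg fun _ _ => mul_nonneg (h.lam_nonneg _) (negMaj_nonneg _ _)

theorem IsParameters.sum_mul_negMaj_le (h : IsParameters ε lam m) (J : ℕ) (x : Past) :
    ∑ j ∈ range J, lam (j + 1) * negMaj (m (j + 1)) x ≤ ∑ j ∈ range J, lam (j + 1) :=
  sum_le_sum fun j _ => mul_le_of_le_one_right (h.lam_nonneg j) (negMaj_le_one _ _)

theorem IsParameters.increasing_truncProb (h : IsParameters ε lam m) (J : ℕ) (r : ℝ) :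
    Increasing (truncProb lam m J r) := by
  intro x y hxy
  have : ∑ j ∈ range J, lam (j + 1) * negMaj (m (j + 1)) y
      ≤ ∑ j ∈ range J, lam (j + 1) * negMaj (m (j + 1)) x :=
    sum_le_sum fun j _ => mul_le_mul_of_nonneg_left (negMaj_anti _ hxy) (h.lam_nonneg j)
  simp only [truncProb]
  linarith

theorem IsParameters.truncProb_bounds (h : IsParameters ε lam m) {J : ℕ} {r : ℝ} (hr0 : -1 / 2 ≤ r)
    (hr1 : ∑ j ∈ range J, lam (j + 1) + r ≤ 1) (x : Past) :
    1 / 4 ≤ truncProb lam m J r x ∧ truncProb lam m J r x ≤ 1 := by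
  have h1 := h.sum_mul_negMaj_nonneg J x
  have h2 := h.sum_mul_negMaj_le J x
  constructor <;> simp only [truncProb] <;> linarith

theorem IsParameters.isProb_truncProb (h : IsParameters ε lam m) {J : ℕ} {r : ℝ} (hr0 : -1 / 2 ≤ r)
    (hr1 : ∑ j ∈ range J, lam (j + 1) + r ≤ 1) : IsProb (truncProb lam m J r) := fun x =>
  ⟨by linarith [(h.truncProb_bounds hr0 hr1 x).1], (h.truncProb_bounds hr0 hr1 x).2⟩

theorem dependsOnFirst_truncProb {J M : ℕ} (r : ℝ) (hM : ∀ j < J, m (j + 1) ≤ M) :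
    DependsOnFirst M (truncProb lam m J r) := by
  intro x y hxy
  have : ∀ j ∈ range J, lam (j + 1) * negMaj (m (j + 1)) x = lam (j + 1) * negMaj (m (j + 1)) y :=
    fun j hj => by rw [dependsOnFirst_negMaj (hM j (mem_range.1 hj)) x y hxy]
  simp only [truncProb, sum_congr rfl this]

/-- The truncated chain is biased towards the symbol `1`, because it dominates a symmetric chain. -/
theorem IsParameters.le_step_iterate_truncProb (h : IsParameters ε lam m) {J : ℕ} {R : ℝ}
    (hR0 : 0 ≤ R) (hR : ∑ j ∈ range J, lam (j + 1) = 1 - R) (n : ℕ) :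
    R / 4 ≤ (step (truncProb lam m J (R / 4)))^[n + 1] spin (allEq 1) := by
  have hsum0 : 0 ≤ ∑ j ∈ range J, lam (j + 1) := sum_nonneg fun j _ => h.lam_nonneg j
  have hq : IsProb (truncProb lam m J (R / 4)) :=
    h.isProb_truncProb (by linarith) (by linarith)
  have hs : IsProb (truncProb lam m J (R / 2)) :=
    h.isProb_truncProb (by linarith) (by linarith)
  -- `R / 2` is exactly half of the missing weight, which makes this chain symmetric.
  have hflip : ∀ x, truncProb lam m J (R / 2) (flip x) = 1 - truncProb lam m J (R / 2) x := by
    intro x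
    have : ∑ j ∈ range J, lam (j + 1) * negMaj (m (j + 1)) (flip x)
        = (1 - R) - ∑ j ∈ range J, lam (j + 1) * negMaj (m (j + 1)) x := by
      rw [← hR, ← sum_sub_distrib]
      refine sum_congr rfl fun j _ => ?_
      rw [negMaj_flip (h.odd _ (by omega))]
      ring
    simp only [truncProb, this]
    ring
  have hodd : ∀ j, 0 ≤ (step (truncProb lam m J (R / 4)))^[n]
      (fun x => 1 / 2 - negMaj (m (j + 1)) x) (allEq 1) := by
    intro j
    have hinc : Increasing fun x => 1 / 2 - negMaj (m (j + 1)) x := fun x y hxy => by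
      linarith [negMaj_anti (m (j + 1)) hxy]
    have h1 := step_iterate_odd_nonneg hs (h.increasing_truncProb J _) hflip hinc
      (fun x => by rw [negMaj_flip (h.odd _ (by omega))]; ring) n
    refine h1.trans (step_iterate_le_of_le hq hs (h.increasing_truncProb J _) (fun x => ?_) hinc
      (a := -1 / 2) (fun x => ?_) (fun x => ?_) n _)
    · simp only [truncProb]; linarith
    · linarith [negMaj_le_one (m (j + 1)) x]
    · linarith [negMaj_nonneg (m (j + 1)) x]
  -- The next symbol has mean `2q - 1`; the constant `R / 4` is the excess over the symmetric chain,
  -- and the remaining terms are odd.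
  have hspin : step (truncProb lam m J (R / 4)) spin
      = fun x => R / 4 + ∑ j ∈ range J, lam (j + 1) * (1 / 2 - negMaj (m (j + 1)) x) := by
    funext x
    simp only [mul_sub, sum_sub_distrib, ← sum_mul, hR]
    simp only [step, spin, truncProb, concat, Units.val_one, Units.val_neg, Int.cast_one,
      Int.cast_neg]
    ring
  rw [Function.iterate_succ_apply, hspin, step_iterate_add, step_iterate_const, step_iterate_sum]
  have : 0 ≤ ∑ j ∈ range J, (step (truncProb lam m J (R / 4)))^[n]
      (fun x => lam (j + 1) * (1 / 2 - negMaj (m (j + 1)) x)) (allEq 1) :=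
    sum_nonneg fun j _ => by
      rw [step_iterate_const_mul]
      exact mul_nonneg (h.lam_nonneg j) (hodd j)
  linarith

/-- Chernoff bound: `negMaj` is at most the exponential weight, whose expectation is controlled with
bias `r = R / 4` and minorization `ρ = 1 / 4`. -/
theorem IsParameters.step_iterate_truncProb_negMaj_le (h : IsParameters ε lam m) {J : ℕ} {R : ℝ}
    (hR0 : 0 < R) (hR : ∑ j ∈ range J, lam (j + 1) = 1 - R) {M : ℕ} (hM : 1 ≤ M)
    (hmM : ∀ j < J, m (j + 1) ≤ M) {N : ℕ} (hN : 16 * M * 4 ^ M ≤ R * N) (k : ℕ) (x : Past) :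
    (step (truncProb lam m J (R / 4)))^[k] (negMaj k) x ≤ 3 * (1 - R ^ 2 / 256) ^ (k / N) := by
  have hsum0 : 0 ≤ ∑ j ∈ range J, lam (j + 1) := sum_nonneg fun j _ => h.lam_nonneg j
  have hr0 : -1 / 2 ≤ R / 4 := by linarith
  have hr1 : ∑ j ∈ range J, lam (j + 1) + R / 4 ≤ 1 := by linarith
  have hq := h.isProb_truncProb hr0 hr1
  have h1 := step_iterate_expWeight_le hq (h.increasing_truncProb J _) (ρ := 1 / 4) (by norm_num)
    (fun x => (h.truncProb_bounds hr0 hr1 x).1) hM (dependsOnFirst_truncProb _ hmM)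
    (r := R / 4) (by linarith) (by linarith) (h.le_step_iterate_truncProb hR0.le hR) (N := N)
    (by rw [one_div, inv_pow, div_inv_eq_mul]; linarith) k x
  have h2 := step_iterate_mono hq k
    (fun y => negMaj_le_expWeight (s := R / 4 / (4 * N)) (by positivity) k y) x
  refine (h2.trans h1).trans (le_of_eq ?_)
  congr 2
  ring

end Parameters

/-- Bound for the chain started from the largest past in terms of an attractive comparison chain
started from an arbitrary past. -/
theorem step_iterate_negMaj_le {q q' e : Past → ℝ} (hq : IsProb q) (hq' : IsProb q')
    (hqm' : Increasing q') (he : ∀ x, 0 ≤ e x) (hqe : ∀ x, q' x - e x ≤ q x) {k : ℕ} {Z E : ℝ}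
    (hZ : ∀ x, (step q')^[k] (negMaj k) x ≤ Z) {n : ℕ}
    (hE : ∀ i < n, (step q)^[i] e (allEq 1) ≤ E) (hE0 : 0 ≤ E) :
    (step q)^[n] (negMaj k) (allEq 1) ≤ Z + k * E := by
  have hneg : ∀ (p : Past → ℝ) (n : ℕ) (x : Past),
      (step p)^[n] (fun y => -negMaj k y) x = -(step p)^[n] (negMaj k) x := by
    intro p n x
    have := step_iterate_const_mul p n (-1) (negMaj k) x
    simpa using this
  have hinc : Increasing fun y => -negMaj k y := fun x y h => by linarith [negMaj_anti k h]
  have hcomp := step_iterate_ge_sub hq hq' hqm' he hqe hinc (a := -1)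
    (fun x => by linarith [negMaj_le_one k x]) (fun x => by linarith [negMaj_nonneg k x])
  simp only [hneg] at hcomp
  -- If `k ≤ n`, the comparison covers only the last `k` steps, starting from whatever past the true
  -- chain has reached.
  rcases le_total k n with hkn | hkn
  · obtain ⟨d, rfl⟩ := Nat.exists_eq_add_of_le' hkn
    have h1 : ∀ x, (step q)^[k] (negMaj k) x ≤ Z + ∑ i ∈ range k, (step q)^[i] e x := fun x => by
      linarith [hcomp k x, hZ x]
    have h2 := step_iterate_mono hq d h1 (allEq 1)
    rw [step_iterate_add, step_iterate_const, step_iterate_sum] at h2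
    rw [Function.iterate_add_apply]
    have h3 : ∑ i ∈ range k, (step q)^[d] ((step q)^[i] e) (allEq 1) ≤ ∑ i ∈ range k, E :=
      sum_le_sum fun i hi => by
        rw [← Function.iterate_add_apply]
        exact hE _ (by have := mem_range.1 hi; omega)
    simp only [sum_const, card_range, nsmul_eq_mul] at h3
    linarith
  -- If `n ≤ k`, part of the window is still the initial ones; from there the comparison chain's
  -- probability of a negative majority increases with time, so its value at time `k` bounds it.
  · have h1 := hcomp n (allEq 1)
    have h2 := step_iterate_allEq_one_anti hq' hqm' hinc hkn
    rw [hneg, hneg] at h2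
    have h3 : ∑ i ∈ range n, (step q)^[i] e (allEq 1) ≤ ∑ i ∈ range n, E :=
      sum_le_sum fun i hi => hE _ (mem_range.1 hi)
    simp only [sum_const, card_range, nsmul_eq_mul] at h3
    have h4 : (n : ℝ) * E ≤ k * E := mul_le_mul_of_nonneg_right (by exact_mod_cast hkn) hE0
    linarith [hZ (allEq 1)]


/-! ### Numerical estimate for the exponential decay. -/

theorem self_le_two_rpow {X : ℝ} (hX : 1 ≤ X) : X ≤ 2 ^ X := by
  have := one_add_mul_self_le_rpow_one_add (s := 1) (by norm_num) hX
  norm_num at this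
  linarith

/-- The relaxation time `N` is at most `17 X² 2^(2X)`, so `k ≥ 2^(11X)` contains at least `6 X⁶`
blocks of length `N`. Each contributes a factor at most `exp (-1 / X⁴)`, in total `exp (-6 X²)`. -/
theorem exponential_decay_bound {X R : ℝ} {M k N : ℕ} (hX : 128 ≤ X) (hR : 1 / X ≤ R) (hR1 : R ≤ 1)
    (hMX : (M : ℝ) ≤ X) (hk : (2 : ℝ) ^ (11 * X) ≤ k)
    (hN0 : 0 < N) (hN : (N : ℝ) ≤ 16 * M * 4 ^ M / R + 1) :
    3 * (1 - R ^ 2 / 256) ^ (k / N) ≤ 1 / (2 * X ^ 2) := by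
  have hX0 : 0 < X := by linarith
  have hR0 : 0 < R := lt_of_lt_of_le (by positivity) hR
  have h4 : (4 : ℝ) ^ M ≤ 2 ^ (2 * X) := by
    have h : (2 : ℝ) ^ (2 * X) = 4 ^ X := by
      rw [Real.rpow_mul (by norm_num)]
      norm_num
    rw [h, ← Real.rpow_natCast]
    exact Real.rpow_le_rpow_of_exponent_le (by norm_num) hMX
  have hP : (1 : ℝ) ≤ 2 ^ (2 * X) := Real.one_le_rpow (by norm_num) (by linarith)
  have hRX : 1 / R ≤ X := by
    rw [div_le_iff₀ hR0]
    rw [div_le_iff₀ hX0] at hR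
    linarith
  have hNle : (N : ℝ) ≤ 17 * X ^ 2 * 2 ^ (2 * X) := by
    have h1 : 16 * M * 4 ^ M / R ≤ 16 * X * 2 ^ (2 * X) * X := by
      rw [div_eq_mul_one_div]
      gcongr
    have h2 : 1 ≤ X ^ 2 * (2 : ℝ) ^ (2 * X) := one_le_mul_of_one_le_of_one_le (by nlinarith) hP
    nlinarith
  have hNk : 7 * X ^ 6 * N ≤ k := by
    have h1 : (2 : ℝ) ^ (11 * X) = (2 ^ X) ^ 9 * 2 ^ (2 * X) := by
      rw [← Real.rpow_mul_natCast (by norm_num), ← Real.rpow_add (by norm_num)]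
      congr 1
      push_cast
      ring
    have h2 : X ^ 9 ≤ ((2 : ℝ) ^ X) ^ 9 :=
      pow_le_pow_left₀ hX0.le (self_le_two_rpow (by linarith)) 9
    have h3 : 119 * X ^ 8 ≤ X ^ 9 := by
      have : 0 ≤ X ^ 8 * (X - 119) := mul_nonneg (by positivity) (by linarith)
      linarith
    calc 7 * X ^ 6 * N ≤ 7 * X ^ 6 * (17 * X ^ 2 * 2 ^ (2 * X)) := by gcongr
      _ = 119 * X ^ 8 * 2 ^ (2 * X) := by ring
      _ ≤ (2 ^ X) ^ 9 * 2 ^ (2 * X) := by gcongr; linarith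
      _ ≤ k := by rw [← h1]; exact hk
  have hN0' : (0 : ℝ) < N := by exact_mod_cast hN0
  have ht : 6 * X ^ 6 ≤ (k / N : ℕ) := by
    have h1 : (k : ℝ) < N * ((k / N : ℕ) + 1) := by
      have := Nat.lt_mul_div_succ k hN0
      exact_mod_cast this
    have h2 : N * (7 * X ^ 6) < N * (((k / N : ℕ) : ℝ) + 1) := by linarith
    have h3 := lt_of_mul_lt_mul_left h2 hN0'.le
    have h5 : (1 : ℝ) ≤ X ^ 6 := one_le_pow₀ (by linarith)
    linarith
  have hx : 1 / X ^ 4 ≤ R ^ 2 / 256 := by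
    have h1 : (1 / X) ^ 2 ≤ R ^ 2 := pow_le_pow_left₀ (by positivity) hR 2
    have h2 : 1 / X ^ 4 = (1 / X) ^ 2 * (1 / X ^ 2) := by field_simp
    have h3 : 1 / X ^ 2 ≤ 1 / 256 := one_div_le_one_div_of_le (by norm_num) (by nlinarith)
    rw [h2]
    linarith [mul_le_mul h1 h3 (by positivity) (sq_nonneg R)]
  have hbase : 1 - R ^ 2 / 256 ≤ Real.exp (-(1 / X ^ 4)) := by
    linarith [Real.add_one_le_exp (-(1 / X ^ 4))]
  have hbase0 : 0 ≤ 1 - R ^ 2 / 256 := by nlinarith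
  have hpow : (1 - R ^ 2 / 256) ^ (k / N) ≤ 1 / (6 * X ^ 2) := by
    calc (1 - R ^ 2 / 256) ^ (k / N) ≤ Real.exp (-(1 / X ^ 4)) ^ (k / N) :=
          pow_le_pow_left₀ hbase0 hbase _
      _ = Real.exp (-((k / N : ℕ) * (1 / X ^ 4))) := by rw [← Real.exp_nat_mul]; ring_nf
      _ ≤ Real.exp (-(6 * X ^ 2)) := by
          refine Real.exp_le_exp.2 (neg_le_neg ?_)
          calc 6 * X ^ 2 = 6 * X ^ 6 * (1 / X ^ 4) := by field_simp
            _ ≤ _ := by gcongr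
      _ ≤ 1 / (6 * X ^ 2) := by
          rw [Real.exp_neg, ← one_div]
          exact one_div_le_one_div_of_le (by positivity) (by linarith [Real.add_one_le_exp (6 * X ^ 2)])
  calc _ ≤ 3 * (1 / (6 * X ^ 2)) := by gcongr
    _ = _ := by field_simp; norm_num

/-! ### Block structure of the weights and growth of the scales. -/

/-- The last index of the `l`-th block. -/
def blockEnd (b : ℕ → ℕ) (l : ℕ) : ℕ := ∑ k ∈ Icc 1 l, b k

/-- Scales growing like `2 ^ (c * j ^ 2)` whose weights are uniform on long blocks. -/
structure IsBlockModel (c : ℝ) (m b : ℕ → ℕ) (lam : ℕ → ℝ) : Prop where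
  seven_le : 7 ≤ c
  scale_le : ∀ j, 1 ≤ j → (m j : ℝ) ≤ 2 ^ (c * (j : ℝ) ^ 2)
  le_scale : ∀ j : ℕ, 1 ≤ j → (2 : ℝ) ^ (c * (j : ℝ) ^ 2) < m j + 2
  odd : ∀ j, 1 ≤ j → Odd (m j)
  block_one : b 1 = 1
  le_block : ∀ l, 1 ≤ l → (2 : ℝ) ^ ((c * (blockEnd b l : ℝ)) ^ 2) ≤ b (l + 1)
  weight : ∀ l, ∀ i < b (l + 1),
    lam (blockEnd b l + i + 1) = (3 / 4 : ℝ) ^ l / (4 * (b (l + 1) : ℝ))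

theorem blockEnd_zero (b : ℕ → ℕ) : blockEnd b 0 = 0 := rfl

theorem blockEnd_succ (b : ℕ → ℕ) (l : ℕ) : blockEnd b (l + 1) = blockEnd b l + b (l + 1) :=
  sum_Icc_succ_top (by omega) b

/-- An upper bound of the scales of the first `l` blocks. -/
noncomputable def blockScale (c : ℝ) (b : ℕ → ℕ) (l : ℕ) : ℝ :=
  2 ^ (c * (blockEnd b l : ℝ) ^ 2)

namespace IsBlockModel

variable {c : ℝ} {m b : ℕ → ℕ} {lam : ℕ → ℝ}

theorem block_pos (h : IsBlockModel c m b lam) (l : ℕ) : 1 ≤ b (l + 1) := by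
  rcases Nat.eq_zero_or_pos l with rfl | hl
  · rw [zero_add, h.block_one]
  · have h1 : (0 : ℝ) < b (l + 1) := lt_of_lt_of_le (by positivity) (h.le_block l hl)
    exact_mod_cast h1

theorem le_blockEnd (h : IsBlockModel c m b lam) (l : ℕ) : l ≤ blockEnd b l := by
  induction l with
  | zero => omega
  | succ l ih => rw [blockEnd_succ]; have := h.block_pos l; omega

theorem blockEnd_mono (b : ℕ → ℕ) : Monotone (blockEnd b) :=
  monotone_nat_of_le_succ fun l => by rw [blockEnd_succ]; omega

theorem blockScale_mono (h : IsBlockModel c m b lam) {k l : ℕ} (hkl : k ≤ l) :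
    blockScale c b k ≤ blockScale c b l := by
  have h1 : (blockEnd b k : ℝ) ≤ blockEnd b l := by exact_mod_cast blockEnd_mono b hkl
  have hc := h.seven_le
  unfold blockScale
  refine Real.rpow_le_rpow_of_exponent_le (by norm_num) ?_
  exact mul_le_mul_of_nonneg_left (pow_le_pow_left₀ (by positivity) h1 2) (by linarith)

theorem le_blockScale (h : IsBlockModel c m b lam) {l : ℕ} (hl : 1 ≤ l) :
    128 ≤ blockScale c b l := by
  have h1 : (1 : ℝ) ≤ blockEnd b l := by exact_mod_cast hl.trans (h.le_blockEnd l)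
  have hc := h.seven_le
  calc (128 : ℝ) = 2 ^ (7 : ℝ) := by norm_num
    _ ≤ _ := Real.rpow_le_rpow_of_exponent_le (by norm_num) (by nlinarith)

/-- With `B` the block end, `(c B)² ≥ 7 c B²` because `c ≥ 7`. This makes the uncontrolled initial
part of each block negligible. -/
theorem blockScale_pow_le_block (h : IsBlockModel c m b lam) {l : ℕ} (hl : 1 ≤ l) :
    blockScale c b l ^ 7 ≤ b (l + 1) := by
  refine le_trans ?_ (h.le_block l hl)
  have hc := h.seven_le
  rw [blockScale, ← Real.rpow_mul_natCast (by norm_num)]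
  refine Real.rpow_le_rpow_of_exponent_le (by norm_num) ?_
  have : 0 ≤ c * (c - 7) * (blockEnd b l : ℝ) ^ 2 :=
    mul_nonneg (mul_nonneg (by linarith) (by linarith)) (sq_nonneg _)
  push_cast
  nlinarith

/-- The new block at least doubles the block end, so the exponent at least quadruples. -/
theorem blockScale_pow_le_succ (h : IsBlockModel c m b lam) {l : ℕ} (hl : 1 ≤ l) :
    blockScale c b l ^ 4 ≤ blockScale c b (l + 1) := by
  have hc := h.seven_le
  have h1 : (blockEnd b l : ℝ) ≤ b (l + 1) := by
    have h2 := h.le_block l hl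
    have h3 : (1 : ℝ) ≤ blockEnd b l := by exact_mod_cast hl.trans (h.le_blockEnd l)
    refine le_trans ((self_le_two_rpow h3).trans ?_) h2
    refine Real.rpow_le_rpow_of_exponent_le (by norm_num) ?_
    nlinarith [mul_le_mul h3 hc (by norm_num) (by linarith)]
  rw [blockScale, blockScale, ← Real.rpow_mul_natCast (by norm_num), blockEnd_succ]
  refine Real.rpow_le_rpow_of_exponent_le (by norm_num) ?_
  push_cast
  have h0 : (0 : ℝ) ≤ blockEnd b l := by positivity
  have : (2 * (blockEnd b l : ℝ)) ^ 2 ≤ (blockEnd b l + b (l + 1)) ^ 2 := by gcongr; linarith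
  nlinarith

theorem sum_weight (h : IsBlockModel c m b lam) (l : ℕ) :
    ∑ j ∈ range (blockEnd b l), lam (j + 1) = 1 - (3 / 4) ^ l := by
  induction l with
  | zero => simp [blockEnd_zero]
  | succ l ih =>
    have hb : (b (l + 1) : ℝ) ≠ 0 := by have := h.block_pos l; positivity
    rw [blockEnd_succ, sum_range_add, ih, sum_congr rfl fun i hi => h.weight l i (mem_range.1 hi),
      sum_const, card_range, nsmul_eq_mul, pow_succ]
    field_simp
    ring

theorem exists_block (h : IsBlockModel c m b lam) {j : ℕ} (hj : 1 ≤ j) :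
    ∃ l, ∃ i < b (l + 1), j = blockEnd b l + i + 1 := by
  have hex : ∃ l, j ≤ blockEnd b l := ⟨j, h.le_blockEnd j⟩
  have h1 := Nat.find_spec hex
  obtain ⟨l, hl⟩ : ∃ l, Nat.find hex = l + 1 := by
    refine Nat.exists_eq_succ_of_ne_zero fun h0 => ?_
    rw [h0, blockEnd_zero] at h1
    omega
  have h2 := Nat.find_min hex (m := l) (by omega)
  rw [hl, blockEnd_succ] at h1
  exact ⟨l, j - blockEnd b l - 1, by omega, by omega⟩

theorem weight_pos (h : IsBlockModel c m b lam) {j : ℕ} (hj : 1 ≤ j) : 0 < lam j := by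
  obtain ⟨l, i, hi, rfl⟩ := h.exists_block hj
  have := h.block_pos l
  rw [h.weight l i hi]
  positivity

theorem hasSum_weight (h : IsBlockModel c m b lam) : HasSum (fun j => lam (j + 1)) 1 := by
  have h0 : ∀ j, 0 ≤ lam (j + 1) := fun j => (h.weight_pos (by omega)).le
  have hmono : Monotone fun n => ∑ j ∈ range n, lam (j + 1) := fun a b hab =>
    sum_le_sum_of_subset_of_nonneg (range_mono hab) fun j _ _ => h0 j
  rw [hasSum_iff_tendsto_nat_of_nonneg h0]
  have hB : Tendsto (blockEnd b) atTop atTop :=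
    tendsto_atTop_mono h.le_blockEnd tendsto_id
  rw [tendsto_iff_tendsto_subseq_of_monotone hmono hB]
  have h1 : Tendsto (fun l : ℕ => 1 - (3 / 4 : ℝ) ^ l) atTop (𝓝 (1 - 0)) :=
    tendsto_const_nhds.sub (tendsto_pow_atTop_nhds_zero_of_lt_one (by norm_num) (by norm_num))
  rw [sub_zero] at h1
  exact h1.congr fun l => (h.sum_weight l).symm

theorem strictMono_scale (h : IsBlockModel c m b lam) {i j : ℕ} (hi : 1 ≤ i) (hij : i < j) :
    m i < m j := by
  have hc := h.seven_le
  have h1 := h.scale_le i hi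
  have h2 := h.le_scale j (by omega)
  have h3 : (i : ℝ) + 1 ≤ j := by exact_mod_cast hij
  have hi' : (1 : ℝ) ≤ i := by exact_mod_cast hi
  -- A factor `4` between consecutive powers outweighs the loss of up to `2` in rounding to an odd
  -- integer.
  have h4 : (2 : ℝ) ^ (c * (i : ℝ) ^ 2 + 2) ≤ 2 ^ (c * (j : ℝ) ^ 2) := by
    refine Real.rpow_le_rpow_of_exponent_le (by norm_num) ?_
    have : ((i : ℝ) + 1) ^ 2 ≤ (j : ℝ) ^ 2 := by gcongr
    nlinarith
  rw [Real.rpow_add (by norm_num)] at h4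
  have h5 : (1 : ℝ) ≤ 2 ^ (c * (i : ℝ) ^ 2) := Real.one_le_rpow (by norm_num) (by positivity)
  norm_num at h4
  have : (m i : ℝ) < m j := by linarith
  exact_mod_cast this

theorem isParameters (h : IsBlockModel c m b lam) : IsParameters (1 / 4) lam m where
  eps_pos := by norm_num
  eps_lt_half := by norm_num
  odd := h.odd
  increasing _ _ := h.strictMono_scale
  pos _ := h.weight_pos
  hasSum := h.hasSum_weight

/-! ### Induction on time over all large scales. -/

/-- The expected weight of negative majorities beyond a block is small if the majorities at the
large scales of the later blocks are rarely negative. -/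
theorem step_iterate_negTail_le (h : IsBlockModel c m b lam) {n : ℕ}
    (hn : ∀ l, 1 ≤ l → ∀ i < b (l + 1), blockScale c b l ≤ i →
      (step (plusProb lam m))^[n] (negMaj (m (blockEnd b l + i + 1))) (allEq 1)
        ≤ 1 / blockScale c b l ^ 2)
    {L : ℕ} (hL : 1 ≤ L) :
    (step (plusProb lam m))^[n] (negTail lam m (blockEnd b L)) (allEq 1)
      ≤ 2 / blockScale c b L ^ 2 := by
  have hp := h.isParameters
  have hq := hp.isProb_plusProb
  set w : ℕ → ℝ := fun j => (step (plusProb lam m))^[n] (negMaj (m j)) (allEq 1) with hw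
  have hw0 : ∀ j, 0 ≤ w j := fun j => le_step_iterate hq n (negMaj_nonneg _) _
  have hw1 : ∀ j, w j ≤ 1 := fun j => step_iterate_le hq n (negMaj_le_one _) _
  set T : ℝ := 2 / blockScale c b L ^ 2 with hT
  have hX := h.le_blockScale hL
  have hT0 : 0 ≤ T := by positivity
  have hsum := step_iterate_hasSum (q := plusProb lam m) n
    (fun x => (hp.summable_negTail (blockEnd b L) x).hasSum) (allEq 1)
  simp only [step_iterate_const_mul] at hsum
  have hblock : ∀ l, L ≤ l → ∑ i ∈ range (b (l + 1)),
      lam (blockEnd b l + i + 1) * w (blockEnd b l + i + 1) ≤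
      T * ∑ i ∈ range (b (l + 1)), lam (blockEnd b l + i + 1) := by
    intro l hl
    have hl1 : 1 ≤ l := hL.trans hl
    set X := blockScale c b l with hXl
    have hX1 : 128 ≤ X := h.le_blockScale hl1
    have hb0 : (0 : ℝ) < b (l + 1) := by have := h.block_pos l; positivity
    have hbX : X ^ 7 ≤ b (l + 1) := h.blockScale_pow_le_block hl1
    have hweq : ∀ i ∈ range (b (l + 1)), lam (blockEnd b l + i + 1)
        = (3 / 4 : ℝ) ^ l / (4 * (b (l + 1) : ℝ)) := fun i hi => h.weight l i (mem_range.1 hi)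
    -- The first `⌈X⌉₊` scales are bounded trivially by `1`, the others by `1 / X²`. As `b (l + 1) ≥
    -- X⁷`, the former add at most another `1 / X²` on average.
    have hcount : ∑ i ∈ range (b (l + 1)), w (blockEnd b l + i + 1) ≤ b (l + 1) * T := by
      have h1 : ∀ i ∈ range (b (l + 1)), w (blockEnd b l + i + 1)
          ≤ (if i < ⌈X⌉₊ then 1 else 0) + 1 / X ^ 2 := by
        intro i hi
        split_ifs with hix
        · have : 0 ≤ 1 / X ^ 2 := by positivity
          linarith [hw1 (blockEnd b l + i + 1)]
        · rw [zero_add]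
          exact hn l hl1 i (mem_range.1 hi) ((Nat.le_ceil X).trans (by exact_mod_cast not_lt.1 hix))
      have h2 : ∑ i ∈ range (b (l + 1)), (if i < ⌈X⌉₊ then (1 : ℝ) else 0) ≤ 2 * X := by
        rw [← sum_filter, sum_const, nsmul_eq_mul, mul_one]
        have h3 : #{i ∈ range (b (l + 1)) | i < ⌈X⌉₊} ≤ ⌈X⌉₊ := by
          rw [← card_range ⌈X⌉₊]
          exact card_le_card fun i hi => by simp at hi ⊢; exact hi.2
        have h4 : ((#{i ∈ range (b (l + 1)) | i < ⌈X⌉₊} : ℕ) : ℝ) ≤ ⌈X⌉₊ := by exact_mod_cast h3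
        linarith [Nat.ceil_lt_add_one (by linarith : 0 ≤ X)]
      have h3 := sum_le_sum h1
      rw [sum_add_distrib, sum_const, card_range, nsmul_eq_mul] at h3
      have h5 : 2 * X ≤ b (l + 1) * (1 / X ^ 2) := by
        rw [mul_one_div, le_div_iff₀ (by positivity)]
        refine le_trans ?_ hbX
        have : 0 ≤ X ^ 3 * (X ^ 4 - 2) := mul_nonneg (by positivity) (by nlinarith [one_le_pow₀ (by linarith : 1 ≤ X) (n := 3)])
        nlinarith
      have h6 : 2 / X ^ 2 ≤ T := by
        rw [hT]
        have := h.blockScale_mono hl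
        gcongr
      calc _ ≤ 2 * X + b (l + 1) * (1 / X ^ 2) := by linarith
        _ ≤ b (l + 1) * (2 / X ^ 2) := by
          rw [show (2 : ℝ) / X ^ 2 = 1 / X ^ 2 + 1 / X ^ 2 by ring, mul_add]; linarith
        _ ≤ _ := by gcongr
    rw [sum_congr rfl fun i hi => by rw [hweq i hi], ← mul_sum, sum_congr rfl hweq, sum_const,
      card_range, nsmul_eq_mul]
    calc _ ≤ (3 / 4 : ℝ) ^ l / (4 * (b (l + 1) : ℝ)) * (b (l + 1) * T) := by gcongr
      _ = _ := by ring
  have hpart : ∀ p, ∑ j ∈ range (blockEnd b (L + p)), lam (j + 1) * w (j + 1)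
      - ∑ j ∈ range (blockEnd b L), lam (j + 1) * w (j + 1) ≤
      T * (∑ j ∈ range (blockEnd b (L + p)), lam (j + 1)
        - ∑ j ∈ range (blockEnd b L), lam (j + 1)) := by
    intro p
    induction p with
    | zero => simp
    | succ p ih =>
      rw [← add_assoc, blockEnd_succ, sum_range_add, sum_range_add]
      linarith [hblock (L + p) (by omega)]
  refine le_of_eq_of_le hsum.tsum_eq.symm (Real.tsum_le_of_sum_range_le
    (fun j => mul_nonneg (hp.lam_nonneg _) (hw0 _)) fun n => ?_)
  have h1 := sum_range_add (fun j => lam (j + 1) * w (j + 1)) (blockEnd b L) n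
  have h2 : ∑ j ∈ range (blockEnd b L + n), lam (j + 1) * w (j + 1)
      ≤ ∑ j ∈ range (blockEnd b (L + n)), lam (j + 1) * w (j + 1) := by
    refine sum_le_sum_of_subset_of_nonneg (range_mono ?_) fun j _ _ =>
      mul_nonneg (hp.lam_nonneg _) (hw0 _)
    clear h1
    induction n with
    | zero => simp
    | succ n ih => rw [← add_assoc, ← add_assoc, blockEnd_succ]; have := h.block_pos (L + n); omega
  have h3 := hpart n
  rw [h.sum_weight, h.sum_weight] at h3
  have h4 : (3 / 4 : ℝ) ^ L ≤ 1 := pow_le_one₀ (by norm_num) (by norm_num)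
  have h5 : (0 : ℝ) ≤ (3 / 4 : ℝ) ^ (L + n) := by positivity
  have h6 : T * (1 - (3 / 4) ^ (L + n) - (1 - (3 / 4) ^ L)) ≤ T * 1 := by gcongr; linarith
  linarith

/-- A scale of a block is compared with the truncated chain of the previous blocks. -/
theorem step_iterate_negMaj_block_le (h : IsBlockModel c m b lam) {n l i : ℕ} (hi : i < b (l + 1))
    {Z : ℝ} (hZ : ∀ x, (step (truncProb lam m (blockEnd b l) ((3 / 4) ^ l / 4)))^[
      m (blockEnd b l + i + 1)] (negMaj (m (blockEnd b l + i + 1))) x ≤ Z)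
    (hn : ∀ k < n, ∀ l, 1 ≤ l → ∀ i < b (l + 1), blockScale c b l ≤ i →
      (step (plusProb lam m))^[k] (negMaj (m (blockEnd b l + i + 1))) (allEq 1)
        ≤ 1 / blockScale c b l ^ 2) :
    (step (plusProb lam m))^[n] (negMaj (m (blockEnd b l + i + 1))) (allEq 1)
      ≤ Z + 1 / blockScale c b (l + 1) := by
  have hp := h.isParameters
  have hR1 : (3 / 4 : ℝ) ^ l ≤ 1 := pow_le_one₀ (by norm_num) (by norm_num)
  have hR0 : (0 : ℝ) < (3 / 4 : ℝ) ^ l := by positivity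
  set e : Past → ℝ := fun x => 1 / 2 * negTail lam m (blockEnd b (l + 1)) x with he
  have hX := h.le_blockScale (l := l + 1) (by omega)
  set X := blockScale c b (l + 1) with hXdef
  have hmain := step_iterate_negMaj_le hp.isProb_plusProb
    (hp.isProb_truncProb (J := blockEnd b l) (r := (3 / 4) ^ l / 4) (by linarith)
      (by rw [h.sum_weight]; linarith))
    (hp.increasing_truncProb _ _) (e := e)
    (fun x => mul_nonneg (by norm_num) (hp.negTail_nonneg _ x)) (fun x => ?_) hZ (n := n)
    (E := 1 / X ^ 2) (fun k hk => ?_) (by positivity)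
  · refine hmain.trans ?_
    -- The comparison runs for at most this many steps, so the error `1 / X²` per step sums to at
    -- most `1 / X`.
    have h1 : (m (blockEnd b l + i + 1) : ℝ) ≤ X := by
      refine (h.scale_le _ (by omega)).trans ?_
      have hc := h.seven_le
      refine Real.rpow_le_rpow_of_exponent_le (by norm_num) ?_
      have : ((blockEnd b l + i + 1 : ℕ) : ℝ) ≤ blockEnd b (l + 1) := by
        rw [blockEnd_succ]; exact_mod_cast (by omega)
      gcongr
    have h2 : (m (blockEnd b l + i + 1) : ℝ) * (1 / X ^ 2) ≤ X * (1 / X ^ 2) := by gcongr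
    have h3 : X * (1 / X ^ 2) = 1 / X := by field_simp
    linarith
  · simp only [he, plusProb, truncProb]
    rw [← hp.sum_add_negTail (blockEnd b (l + 1)) x]
    -- The block containing the scale has total weight `(3/4) ^ l / 4` and is replaced by its worst
    -- case.
    have h1 : ∑ j ∈ range (blockEnd b (l + 1)), lam (j + 1) * negMaj (m (j + 1)) x
        ≤ ∑ j ∈ range (blockEnd b l), lam (j + 1) * negMaj (m (j + 1)) x + (3 / 4) ^ l / 4 := by
      have h2 : ∑ i ∈ range (b (l + 1)),
          lam (blockEnd b l + i + 1) * negMaj (m (blockEnd b l + i + 1)) x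
          ≤ ∑ i ∈ range (b (l + 1)), lam (blockEnd b l + i + 1) :=
        sum_le_sum fun i _ => mul_le_of_le_one_right (hp.lam_nonneg _) (negMaj_le_one _ _)
      have h3 := h.sum_weight (l + 1)
      rw [blockEnd_succ, sum_range_add, h.sum_weight l, pow_succ] at h3
      rw [blockEnd_succ, sum_range_add]
      linarith
    linarith
  · rw [he, step_iterate_const_mul]
    have := h.step_iterate_negTail_le (hn k hk) (L := l + 1) (by omega)
    rw [← hXdef] at this
    calc _ ≤ 1 / 2 * (2 / X ^ 2) := by gcongr
      _ = _ := by ring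

/-- Half of the bound comes from the decay in the truncated chain, half from the accumulated
comparison error, which the induction hypothesis controls at all earlier times and for all later
blocks. -/
theorem step_iterate_negMaj_large_le (h : IsBlockModel c m b lam) (n : ℕ) :
    ∀ l, 1 ≤ l → ∀ i < b (l + 1), blockScale c b l ≤ i →
      (step (plusProb lam m))^[n] (negMaj (m (blockEnd b l + i + 1))) (allEq 1)
        ≤ 1 / blockScale c b l ^ 2 := by
  induction n using Nat.strong_induction_on with
  | _ n ih =>
  intro l hl i hi hiX
  have hp := h.isParameters
  have hc := h.seven_le
  set X := blockScale c b l with hXdef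
  have hX : 128 ≤ X := h.le_blockScale hl
  have hB : 1 ≤ blockEnd b l := hl.trans (h.le_blockEnd l)
  have hR0 : (0 : ℝ) < (3 / 4 : ℝ) ^ l := by positivity
  have hR1 : (3 / 4 : ℝ) ^ l ≤ 1 := pow_le_one₀ (by norm_num) (by norm_num)
  set M := m (blockEnd b l) with hM
  have hM1 : 1 ≤ M := (h.odd _ hB).pos
  have hMX : (M : ℝ) ≤ X := h.scale_le _ hB
  have hmM : ∀ j < blockEnd b l, m (j + 1) ≤ M := by
    intro j hj
    rcases (Nat.succ_le_of_lt hj).eq_or_lt with hj | hj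
    · rw [hM, ← hj]
    · exact (h.strictMono_scale (by omega) hj).le
  set N := ⌈16 * (M : ℝ) * 4 ^ M / (3 / 4 : ℝ) ^ l⌉₊ with hN
  have hM0 : (0 : ℝ) < M := by exact_mod_cast hM1
  have hNpos : 0 < 16 * (M : ℝ) * 4 ^ M / (3 / 4 : ℝ) ^ l := by positivity
  have hRX : 1 / X ≤ (3 / 4 : ℝ) ^ l := by
    rw [one_div, hXdef, blockScale, ← Real.rpow_neg (by norm_num)]
    have h1 : (l : ℝ) ≤ blockEnd b l := by exact_mod_cast h.le_blockEnd l
    have h2 : (1 : ℝ) ≤ blockEnd b l := by exact_mod_cast hB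
    calc (2 : ℝ) ^ (-(c * (blockEnd b l : ℝ) ^ 2)) ≤ 2 ^ (-(l : ℝ)) :=
          Real.rpow_le_rpow_of_exponent_le (by norm_num) (by nlinarith)
      _ = (1 / 2 : ℝ) ^ l := by rw [Real.rpow_neg (by norm_num), Real.rpow_natCast]; simp
      _ ≤ _ := pow_le_pow_left₀ (by norm_num) (by norm_num) l
  -- The index exceeds `X`, so the exponent is at least `7 X² ≥ 11 X + 2`; the extra `2` absorbs the
  -- rounding to an odd integer.
  have hk : (2 : ℝ) ^ (11 * X) ≤ m (blockEnd b l + i + 1) := by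
    have h1 := h.le_scale (blockEnd b l + i + 1) (by omega)
    have h2 : X ≤ ((blockEnd b l + i + 1 : ℕ) : ℝ) := by
      push_cast
      have : (0 : ℝ) ≤ blockEnd b l := by positivity
      linarith
    have h3 : (2 : ℝ) ^ (11 * X + 2) ≤ 2 ^ (c * ((blockEnd b l + i + 1 : ℕ) : ℝ) ^ 2) := by
      refine Real.rpow_le_rpow_of_exponent_le (by norm_num) ?_
      have h4 : X ^ 2 ≤ ((blockEnd b l + i + 1 : ℕ) : ℝ) ^ 2 := by gcongr
      nlinarith
    rw [Real.rpow_add (by norm_num)] at h3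
    have h5 : (1 : ℝ) ≤ 2 ^ (11 * X) := Real.one_le_rpow (by norm_num) (by linarith)
    norm_num at h3 h1 h5 ⊢
    linarith
  have hdecay := exponential_decay_bound (k := m (blockEnd b l + i + 1)) hX hRX hR1 hMX hk
    (N := N) (Nat.ceil_pos.2 hNpos) (Nat.ceil_lt_add_one hNpos.le).le
  have hZ := hp.step_iterate_truncProb_negMaj_le (J := blockEnd b l) hR0 (h.sum_weight l) hM1 hmM
    (N := N) (by
      have := Nat.le_ceil (16 * (M : ℝ) * 4 ^ M / (3 / 4 : ℝ) ^ l)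
      rw [div_le_iff₀ hR0] at this
      linarith) (m (blockEnd b l + i + 1))
  have hmain := h.step_iterate_negMaj_block_le hi (fun x => (hZ x).trans hdecay) ih
  have hnext : 1 / blockScale c b (l + 1) ≤ 1 / (2 * X ^ 2) := by
    refine one_div_le_one_div_of_le (by positivity) (le_trans ?_ (h.blockScale_pow_le_succ hl))
    rw [← hXdef]
    nlinarith [mul_nonneg (sq_nonneg X) (by nlinarith : 0 ≤ X ^ 2 - 2)]
  have : 1 / X ^ 2 = 1 / (2 * X ^ 2) + 1 / (2 * X ^ 2) := by field_simp; norm_num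
  linarith

/-- With no earlier block, the truncated chain is i.i.d. with probability `5/8` of the symbol `1`.
The tilt `log (4/3)` gives `5/8 · 3/4 + 3/8 · 4/3 = 31/32` per symbol. -/
theorem step_iterate_negMaj_first_le (h : IsBlockModel c m b lam) (n : ℕ) :
    (step (plusProb lam m))^[n] (negMaj (m 1)) (allEq 1) ≤ 1 / 4 := by
  have hc := h.seven_le
  have hq : ∀ x, truncProb lam m (blockEnd b 0) ((3 / 4) ^ 0 / 4) x = 5 / 8 := by
    intro x
    simp [truncProb, blockEnd_zero]
    norm_num
  have hprob : IsProb (truncProb lam m (blockEnd b 0) ((3 / 4) ^ 0 / 4)) := fun x => by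
    rw [hq]; norm_num
  have hs : (0 : ℝ) ≤ Real.log (4 / 3) := Real.log_nonneg (by norm_num)
  have hone : ∀ x, (step (truncProb lam m (blockEnd b 0) ((3 / 4) ^ 0 / 4)))^[1]
      (expWeight (Real.log (4 / 3)) 1) x ≤ 31 / 32 := by
    intro x
    rw [Function.iterate_one, step, hq]
    simp only [expWeight, spinSum, sum_range_one, concat, Units.val_one, Units.val_neg,
      Int.cast_one, Int.cast_neg, mul_one, mul_neg, neg_neg, Real.exp_neg]
    rw [Real.exp_log (by norm_num)]
    norm_num
  have hm1 : 127 ≤ m 1 := by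
    have h1 := h.le_scale 1 le_rfl
    have h2 : (2 : ℝ) ^ (7 : ℝ) ≤ 2 ^ (c * ((1 : ℕ) : ℝ) ^ 2) :=
      Real.rpow_le_rpow_of_exponent_le (by norm_num) (by norm_num; linarith)
    norm_num at h1 h2
    have : (126 : ℝ) < m 1 := by linarith
    exact_mod_cast this
  have hZ : ∀ x, (step (truncProb lam m (blockEnd b 0) ((3 / 4) ^ 0 / 4)))^[
      m (blockEnd b 0 + 0 + 1)] (negMaj (m (blockEnd b 0 + 0 + 1))) x ≤ (31 / 32) ^ 127 := by
    intro x
    rw [blockEnd_zero, zero_add, zero_add] at *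
    have h1 := step_iterate_mono hprob (m 1) (negMaj_le_expWeight hs (m 1)) x
    have h2 := step_iterate_expWeight_mul_le hprob (Real.log (4 / 3)) (by norm_num) hone (m 1) x
    rw [one_mul] at h2
    exact (h1.trans h2).trans (pow_le_pow_of_le_one (by norm_num) (by norm_num) hm1)
  have hmain := h.step_iterate_negMaj_block_le (n := n) (h.block_pos 0) hZ
    fun k _ => h.step_iterate_negMaj_large_le k
  rw [blockEnd_zero, zero_add, zero_add] at hmain
  have hX := h.le_blockScale (l := 1) le_rfl
  have h1 : 1 / blockScale c b 1 ≤ 1 / 128 := one_div_le_one_div_of_le (by norm_num) hX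
  have h2 : ((31 : ℝ) / 32) ^ 127 ≤ 1 / 8 := by norm_num
  linarith

end IsBlockModel

end BramsonKalikow

/-! ### The explicit parameters form a block model. -/

theorem corollary2 (c : ℝ) (hc : 7 ≤ c) (m b : ℕ → ℕ) (lam : ℕ → ℝ)
    (hm : ∀ j : ℕ, 1 ≤ j → m j =
      if Even ⌊(2 : ℝ) ^ (c * (j : ℝ) ^ 2)⌋₊ then ⌊(2 : ℝ) ^ (c * (j : ℝ) ^ 2)⌋₊ - 1
      else ⌊(2 : ℝ) ^ (c * (j : ℝ) ^ 2)⌋₊)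
    (hb_one : b 1 = 1)
    (hb : ∀ l : ℕ, 2 ≤ l →
      b l = ⌈(2 : ℝ) ^ ((c * ∑ j ∈ Finset.Icc 1 (l - 1), (b j : ℝ)) ^ 2)⌉₊)
    (hlam : ∀ l : ℕ, 1 ≤ l →
      ∀ j ∈ Finset.Icc ((∑ k ∈ Finset.Icc 1 (l - 1), b k) + 1) (∑ k ∈ Finset.Icc 1 l, b k),
        lam j = (3 / 4 : ℝ) ^ (l - 1) / (4 * (b l : ℝ))) :
    BramsonKalikow.IsParameters (1 / 4) lam m ∧
      BramsonKalikow.HasMultipleCompatible (BramsonKalikow.model (1 / 4) lam m) := by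
  -- Positivity of the floor keeps the natural subtraction of `1` from truncating.
  have hfloor : ∀ j : ℕ, 1 ≤ j → 128 ≤ ⌊(2 : ℝ) ^ (c * (j : ℝ) ^ 2)⌋₊ := by
    intro j hj
    have hj' : (1 : ℝ) ≤ j := by exact_mod_cast hj
    refine Nat.le_floor ?_
    calc ((128 : ℕ) : ℝ) = 2 ^ (7 : ℝ) := by norm_num
      _ ≤ _ := Real.rpow_le_rpow_of_exponent_le (by norm_num) (by nlinarith)
  have hmodel : BramsonKalikow.IsBlockModel c m b lam :=
    { seven_le := hc
      scale_le := fun j hj => by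
        refine le_trans ?_ (Nat.floor_le (by positivity))
        rw [hm j hj]
        split_ifs
        · exact_mod_cast Nat.sub_le _ _
        · exact le_rfl
      le_scale := fun j hj => by
        refine (Nat.lt_floor_add_one _).trans_le ?_
        have h1 := hfloor j hj
        have h2 : ⌊(2 : ℝ) ^ (c * (j : ℝ) ^ 2)⌋₊ + 1 ≤ m j + 2 := by
          rw [hm j hj]
          split_ifs <;> omega
        exact_mod_cast h2
      odd := fun j hj => by
        have h1 := hfloor j hj
        rw [hm j hj]
        split_ifs with h
        · exact Nat.Even.sub_odd (by omega) h odd_one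
        · exact Nat.not_even_iff_odd.1 h
      block_one := hb_one
      le_block := fun l hl => by
        rw [hb (l + 1) (by omega), BramsonKalikow.blockEnd, Nat.add_sub_cancel, Nat.cast_sum]
        exact Nat.le_ceil _
      weight := fun l i hi => by
        have h1 := hlam (l + 1) (by omega) (BramsonKalikow.blockEnd b l + i + 1) (by
          have h2 := BramsonKalikow.blockEnd_succ b l
          simp only [BramsonKalikow.blockEnd] at h2 ⊢
          rw [Finset.mem_Icc, Nat.add_sub_cancel]
          omega)
        rwa [Nat.add_sub_cancel] at h1 }
  exact ⟨hmodel.isParameters, hmodel.isParameters.hasMultipleCompatible (hmodel.odd 1 le_rfl)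
    (by norm_num) hmodel.step_iterate_negMaj_first_le⟩
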